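/- Let $\ell>0$ and let $q\in L^\infty(0,\ell)$ be real valued. For a finite set $Z\subset(0,\ell)$ and $\sigma\in\mathbb R$ let $L_\sigma=L_\sigma^Z$ be the self-adjoint operator $-\frac{d^2}{dx^2}+q(x)$ on $L^2(0,\ell)$ whose domain consists of the functions $u$ that are $H^2$ on each of the intervals into which $Z$ divides $(0,\ell)$ and satisfy $$u(0)=u(\ell)=0,\qquad u(z-)=u(z+),\qquad u'(z+)-u'(z-)=\sigma u(z)\quad\text{for all } z\in Z .$$ For every such $Z$ and $\sigma$ the eigenvalues of $L_\sigma$, repeated according to multiplicity, can be listed in nondecreasing order as $\lambda_1(\sigma)\le\lambda_2(\sigma)\le\cdots$; for $Z=\emptyset$ these are the Dirichlet eigenvalues of $-\frac{d^2}{dx^2}+q$ on $(0,\ell)$. Let $\lambda_*$ be the $k_*$-th Dirichlet eigenvalue ($k_*\ge 1$), let $\phi_*\neq0$ be an eigenfunction for it, and let $Z=\{x\in(0,\ell):\phi_*(x)=0\}$. Then $Z$ is finite, and the ordered eigenvalues $\lambda_n(\sigma)$ of $L_\sigma=L_\sigma^Z$ have the following properties. For every $\sigma\in\mathbb R$ they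 are simple, $\lambda_1(\sigma)<\lambda_2(\sigma)<\cdots$; each $\lambda_n(\sigma)$ is nondecreasing in $\sigma$; $\lambda_{k_*}(\sigma)=\lambda_*$ for all $\sigma$; and $$\lim_{\sigma\to\infty}\lambda_n(\sigma)=\lambda_*\quad(1\le n\le k_*),\qquad \lim_{\sigma\to\infty}\lambda_n(\sigma)>\lambda_*\quad(n>k_*),$$ where the limits exist and are finite. Consequently $\phi_*$ has exactly $k_*$ nodal domains (Sturm's theorem): the set $\{x\in(0,\ell):\phi_*(x)\ne0\}$ has exactly $k_*$ connected components. -/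

import Mathlib

open Set Filter Topology MeasureTheory

namespace DeltaFlow

/-- The function `u` belongs to the Sobolev space `H²(a, b)`, with (weak) second derivative
`g ∈ L²(a, b)`: `u` is differentiable on `(a, b)` and `u'` is an antiderivative of `g`. -/
structure IsH2On (u g : ℝ → ℝ) (a b : ℝ) : Prop where
  memLp : MemLp g 2 (volume.restrict (Ioo a b))
  differentiableOn : DifferentiableOn ℝ u (Ioo a b)
  deriv_sub : ∀ x ∈ Ioo a b, ∀ y ∈ Ioo a b, deriv u y - deriv u x = ∫ t in x..y, g t

/-- `IsImage ℓ q Z σ u f` says that `u` lies in the domain of the operator `L_σ = -d²/dx² + q` on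
`L²(0, ℓ)` and that `L_σ u = f`. Here `Z` is a finite set of points of `(0, ℓ)`. The domain of
`L_σ` consists of the functions which are `H²` on the intervals cut out by `Z`, vanish at `0` and
`ℓ`, are continuous, and satisfy `u'(z+) - u'(z-) = σ u(z)` at every `z ∈ Z`, where `u'(z±)` are
the one-sided derivatives. Functions on `[0, ℓ]` that vanish at the end points are represented by
their extensions by zero to `ℝ`. -/
structure IsImage (ℓ : ℝ) (q : ℝ → ℝ) (Z : Finset ℝ) (σ : ℝ) (u f : ℝ → ℝ) : Prop where
  eq_zero : ∀ x, x ∉ Ioo 0 ℓ → u x = 0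
  continuousOn : ContinuousOn u (Icc 0 ℓ)
  memLp : MemLp f 2 (volume.restrict (Ioo 0 ℓ))
  isH2On : ∀ a b, Ioo a b ⊆ Ioo 0 ℓ \ Z → IsH2On u (fun x => q x * u x - f x) a b
  jump : ∀ z ∈ Z, ∃ p r : ℝ, HasDerivWithinAt u p (Iio z) z ∧
    HasDerivWithinAt u r (Ioi z) z ∧ r - p = σ * u z

theorem IsH2On.intervalIntegrable {u g : ℝ → ℝ} {a b : ℝ} (H : IsH2On u g a b) {x y : ℝ}
    (hx : x ∈ Ioo a b) (hy : y ∈ Ioo a b) : IntervalIntegrable g volume x y := by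
  have h1 : IntegrableOn g (Ioo a b) := H.memLp.integrable (by norm_num)
  exact (h1.mono_set ((convex_Ioo a b).ordConnected.uIcc_subset hx hy)).intervalIntegrable

theorem IsH2On.add {u v g h : ℝ → ℝ} {a b : ℝ} (H : IsH2On u g a b) (K : IsH2On v h a b) :
    IsH2On (u + v) (g + h) a b := by
  refine ⟨H.memLp.add K.memLp, H.differentiableOn.add K.differentiableOn, fun x hx y hy => ?_⟩
  have e : ∀ z ∈ Ioo a b, deriv (u + v) z = deriv u z + deriv v z := fun z hz =>
    deriv_add (H.differentiableOn.differentiableAt (isOpen_Ioo.mem_nhds hz))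
      (K.differentiableOn.differentiableAt (isOpen_Ioo.mem_nhds hz))
  simp only [Pi.add_apply]
  rw [e x hx, e y hy, intervalIntegral.integral_add (H.intervalIntegrable hx hy)
    (K.intervalIntegrable hx hy), ← H.deriv_sub x hx y hy, ← K.deriv_sub x hx y hy]
  ring

theorem IsH2On.smul {u g : ℝ → ℝ} {a b : ℝ} (c : ℝ) (H : IsH2On u g a b) :
    IsH2On (c • u) (c • g) a b := by
  refine ⟨H.memLp.const_smul c, H.differentiableOn.const_smul c, fun x hx y hy => ?_⟩
  have e : ∀ z, deriv (c • u) z = c * deriv u z := fun z => by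
    rw [deriv_const_smul_field]; rfl
  simp only [Pi.smul_apply, smul_eq_mul]
  rw [e, e, intervalIntegral.integral_const_mul, ← H.deriv_sub x hx y hy]
  ring

theorem IsImage.add {ℓ : ℝ} {q : ℝ → ℝ} {Z : Finset ℝ} {σ : ℝ} {u v f g : ℝ → ℝ}
    (H : IsImage ℓ q Z σ u f) (K : IsImage ℓ q Z σ v g) : IsImage ℓ q Z σ (u + v) (f + g) := by
  refine ⟨fun x hx => ?_, H.continuousOn.add K.continuousOn, H.memLp.add K.memLp,
    fun a b hab => ?_, fun z hz => ?_⟩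
  · simp [H.eq_zero x hx, K.eq_zero x hx]
  · convert (H.isH2On a b hab).add (K.isH2On a b hab) using 1
    funext x
    simp only [Pi.add_apply]
    ring
  · obtain ⟨p, r, hp, hr, e⟩ := H.jump z hz
    obtain ⟨p', r', hp', hr', e'⟩ := K.jump z hz
    refine ⟨p + p', r + r', hp.add hp', hr.add hr', ?_⟩
    simp only [Pi.add_apply]
    linarith

theorem IsImage.smul {ℓ : ℝ} {q : ℝ → ℝ} {Z : Finset ℝ} {σ : ℝ} {u f : ℝ → ℝ}
    (c : ℝ) (H : IsImage ℓ q Z σ u f) : IsImage ℓ q Z σ (c • u) (c • f) := by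
  refine ⟨fun x hx => ?_, H.continuousOn.const_smul c, H.memLp.const_smul c,
    fun a b hab => ?_, fun z hz => ?_⟩
  · simp [H.eq_zero x hx]
  · convert (H.isH2On a b hab).smul c using 1
    funext x
    simp only [Pi.smul_apply, smul_eq_mul]
    ring
  · obtain ⟨p, r, hp, hr, e⟩ := H.jump z hz
    refine ⟨c * p, c * r, hp.const_smul c, hr.const_smul c, ?_⟩
    simp only [Pi.smul_apply, smul_eq_mul]
    linear_combination c * e

theorem IsImage.zero (ℓ : ℝ) (q : ℝ → ℝ) (Z : Finset ℝ) (σ : ℝ) : IsImage ℓ q Z σ 0 0 := by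
  refine ⟨fun x _ => rfl, continuousOn_const, MemLp.zero, fun a b _ => ?_, fun z _ => ?_⟩
  · have e : (fun x => q x * (0 : ℝ → ℝ) x - (0 : ℝ → ℝ) x) = 0 := by funext x; simp
    rw [e]
    refine ⟨MemLp.zero, differentiableOn_const 0, fun x _ y _ => ?_⟩
    simp
  · exact ⟨0, 0, hasDerivWithinAt_const _ _ _, hasDerivWithinAt_const _ _ _, by simp⟩

/-- The eigenspace `ker (L_σ - t)`; the real number `t` is an eigenvalue of `L_σ` if and only if
this space is nonzero, and its dimension is the multiplicity of `t`. -/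
def eigenspace (ℓ : ℝ) (q : ℝ → ℝ) (Z : Finset ℝ) (σ t : ℝ) : Submodule ℝ (ℝ → ℝ) where
  carrier := {u | IsImage ℓ q Z σ u (t • u)}
  add_mem' {u v} hu hv := by
    have h := IsImage.add (mem_ofPred_eq ▸ hu) (mem_ofPred_eq ▸ hv)
    rw [← smul_add] at h
    exact h
  zero_mem' := by
    have h := IsImage.zero ℓ q Z σ
    rw [← smul_zero t] at h
    simpa using h
  smul_mem' c u hu := by
    have h := IsImage.smul c (mem_ofPred_eq ▸ hu)
    rw [smul_comm] at h
    exact h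

/-- The eigenspaces of the operator `-d²/dx² + q` on `(0, ℓ)` with Dirichlet boundary conditions:
there are no interior points, so that the coupling constant plays no role. -/
def dirichletEigenspace (ℓ : ℝ) (q : ℝ → ℝ) (t : ℝ) : Submodule ℝ (ℝ → ℝ) :=
  eigenspace ℓ q ∅ 0 t

/-- `lam 1 ≤ lam 2 ≤ ⋯` are the ordered eigenvalues of the operator with the eigenspaces `E t`:
the sequence is nondecreasing, and every real number `t` occurs in it exactly `dim E t` times. -/
structure IsOrderedEigenvalues (E : ℝ → Submodule ℝ (ℝ → ℝ)) (lam : ℕ+ → ℝ) : Prop where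
  monotone : Monotone lam
  finiteDimensional : ∀ t, FiniteDimensional ℝ (E t)
  encard_eq : ∀ t, {n | lam n = t}.encard = Module.finrank ℝ (E t)

/-- The zeros of `φ` in `(0, ℓ)`. -/
def nodalSet (ℓ : ℝ) (φ : ℝ → ℝ) : Set ℝ := {x | x ∈ Ioo 0 ℓ ∧ φ x = 0}

/-- The number of nodal domains of `φ`, the connected components of `{x ∈ (0, ℓ) | φ x ≠ 0}`
(as an element of `ℕ ∪ {∞}`). -/
noncomputable def nodalCount (ℓ : ℝ) (φ : ℝ → ℝ) : ℕ∞ :=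
  ENat.card (ConnectedComponents {x : ℝ // x ∈ Ioo 0 ℓ ∧ φ x ≠ 0})

end DeltaFlow

/-! The proof shoots from `0` and counts with the Prüfer angle. Writing `u = r sin θ`, `u' = r cos
θ` turns `-u'' + q u = t u` into the scalar equation `θ' = cos² θ + (t - q) sin² θ`, and the jump at
a point of `Z` into a map of angles, the `kick`. This map is increasing in the angle, decreasing in
`σ`, and fixes every multiple of `π`. Let `angle` be the resulting total angle at `ℓ`, starting from
`0`. A solution with nonzero initial slope vanishes at `ℓ` exactly when `angle` is a multiple of
`π`. As a function of `t` the angle is continuous and strictly increasing with all positive values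
attained, so `λ_n(σ)` is the unique `t` with `angle = n π`
(`IsOrderedEigenvalues.strictMono_and_angle_eq`). This gives simplicity, and monotonicity in `σ`
follows from `angle_mono`.

At `λ_*` the unkicked angle `θ` of `φ_*` is a multiple of `π` at each point of `Z`, where the kick
does nothing. Hence the total angle is `k_* π` for every `σ` (`angle_eq_of_sin_eq_zero`), so
`λ_{k_*}(σ) = λ_*`.

For `s < λ_*` an angle starting from `0` at one point of `Z` stays below `π` at the next one
(`gap_of_lt`). A strong kick sends angles below `π` to below any given positive bound, so for large
`σ` the total angle at `s` is below `π` (`Gap.eventually_angle_lt`). Then already `λ_1(σ) > s`, and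
`λ_1(σ), …, λ_{k_*}(σ)` are squeezed onto `λ_*`. For `n > k_*`, `λ_n(σ)` is nondecreasing, bounded
uniformly in `σ` by `exists_le_angle`, and its limit is at least `λ_n(0) > λ_*`.

The nodal count does not use the limits: `θ` crosses each multiple of `π` only once, upwards, so `⌊θ
/ π⌋` labels the nodal domains by `0, …, k_* - 1` (`nodalCount_eq`). -/

namespace DeltaFlow

/-! ### Calculus of absolutely continuous functions and Gronwall estimates -/

/-- `f` is absolutely continuous on `[a, b]` with almost everywhere derivative `g`. -/
structure HasAEDeriv (f g : ℝ → ℝ) (a b : ℝ) : Prop where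
  ac : AbsolutelyContinuousOnInterval f a b
  ae : ∀ᵐ x, x ∈ Ioo a b → HasDerivAt f (g x) x

theorem absolutelyContinuousOnInterval_congr {f g : ℝ → ℝ} {a b : ℝ}
    (hf : AbsolutelyContinuousOnInterval f a b) (h : EqOn f g (uIcc a b)) :
    AbsolutelyContinuousOnInterval g a b := by
  rw [absolutelyContinuousOnInterval_iff] at hf ⊢
  intro ε hε
  obtain ⟨δ, hδ, H⟩ := hf ε hε
  refine ⟨δ, hδ, fun E hE hd => ?_⟩
  have := H E hE hd
  rwa [Finset.sum_congr rfl fun i hi => ?_]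
  rw [h (hE.1 i hi).1, h (hE.1 i hi).2]

/-- A `C¹` function is Lipschitz on a compact interval containing the range of `f`. -/
theorem absolutelyContinuousOnInterval_comp {f h h' : ℝ → ℝ} {a b : ℝ}
    (hf : AbsolutelyContinuousOnInterval f a b) (hh : ∀ y, HasDerivAt h (h' y) y)
    (hc : Continuous h') : AbsolutelyContinuousOnInterval (fun x => h (f x)) a b := by
  obtain ⟨C, hC⟩ := hf.exists_bound
  obtain ⟨D, hD⟩ := (isCompact_Icc (a := -C) (b := C)).exists_bound_of_continuousOn hc.continuousOn
  have lip : ∀ x ∈ uIcc a b, ∀ y ∈ uIcc a b, dist (h (f x)) (h (f y)) ≤ |D| * dist (f x) (f y) := by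
    intro x hx y hy
    have := (convex_Icc (-C) C).norm_image_sub_le_of_norm_hasDerivWithin_le
      (fun z _ => (hh z).hasDerivWithinAt) (fun z hz => (hD z hz).trans (le_abs_self D))
      (abs_le.1 (hC y hy)) (abs_le.1 (hC x hx))
    simpa [dist_eq_norm] using this
  rw [absolutelyContinuousOnInterval_iff] at hf ⊢
  intro ε hε
  obtain ⟨δ, hδ, H⟩ := hf (ε / (|D| + 1)) (by positivity)
  refine ⟨δ, hδ, fun E hE hd => ?_⟩
  have h1 := H E hE hd
  rw [lt_div_iff₀ (by positivity)] at h1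
  refine lt_of_le_of_lt ?_ h1
  rw [Finset.sum_mul]
  refine Finset.sum_le_sum fun i hi => (lip _ (hE.1 i hi).1 _ (hE.1 i hi).2).trans ?_
  have := dist_nonneg (x := f (E.2 i).1) (y := f (E.2 i).2)
  nlinarith

theorem ae_restrict_of_Ioo {p : ℝ → Prop} {a b : ℝ} (h : ∀ᵐ x, x ∈ Ioo a b → p x) :
    ∀ᵐ x, x ∈ Ioc a b → p x := by
  have hb : ∀ᵐ x : ℝ, x ≠ b := by simp [ae_iff, measure_singleton]
  filter_upwards [h, hb] with x h1 h2 h3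
  exact h1 ⟨h3.1, lt_of_le_of_ne h3.2 h2⟩

namespace HasAEDeriv

variable {f g u v : ℝ → ℝ} {a b c d : ℝ}

theorem continuousOn (hab : a ≤ b) (H : HasAEDeriv f g a b) : ContinuousOn f (Icc a b) := by
  simpa [uIcc_of_le hab] using H.ac.continuousOn

theorem mono (H : HasAEDeriv f g a b) (hac : a ≤ c) (hcd : c ≤ d) (hdb : d ≤ b) :
    HasAEDeriv f g c d := by
  refine ⟨H.ac.mono ?_, ?_⟩
  · rw [uIcc_of_le hcd, uIcc_of_le (hac.trans (hcd.trans hdb))]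
    exact Icc_subset_Icc hac hdb
  · filter_upwards [H.ae] with x hx h
    exact hx ⟨hac.trans_lt h.1, h.2.trans_le hdb⟩

theorem congr_deriv (H : HasAEDeriv f g a b) (h : ∀ᵐ x, x ∈ Ioo a b → g x = u x) :
    HasAEDeriv f u a b := by
  refine ⟨H.ac, ?_⟩
  filter_upwards [H.ae, h] with x h1 h2 h3
  rw [← h2 h3]
  exact h1 h3

theorem congr (hab : a ≤ b) (H : HasAEDeriv f g a b) (h : EqOn f u (Icc a b)) :
    HasAEDeriv u g a b := by
  refine ⟨absolutelyContinuousOnInterval_congr H.ac (by rwa [uIcc_of_le hab]), ?_⟩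
  filter_upwards [H.ae] with x h1 h2
  refine (h1 h2).congr_of_eventuallyEq ?_
  filter_upwards [isOpen_Ioo.mem_nhds h2] with y hy using (h (Ioo_subset_Icc_self hy)).symm

theorem const (k : ℝ) : HasAEDeriv (fun _ => k) (fun _ => 0) a b :=
  ⟨(LipschitzWith.const k).lipschitzOnWith.absolutelyContinuousOnInterval,
    Eventually.of_forall fun x _ => hasDerivAt_const x k⟩

theorem id : HasAEDeriv (fun x => x) (fun _ => 1) a b :=
  ⟨LipschitzWith.id.lipschitzOnWith.absolutelyContinuousOnInterval,
    Eventually.of_forall fun x _ => hasDerivAt_id x⟩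

theorem add (H : HasAEDeriv f g a b) (K : HasAEDeriv u v a b) :
    HasAEDeriv (fun x => f x + u x) (fun x => g x + v x) a b := by
  refine ⟨H.ac.add K.ac, ?_⟩
  filter_upwards [H.ae, K.ae] with x h1 h2 h3 using (h1 h3).add (h2 h3)

theorem sub (H : HasAEDeriv f g a b) (K : HasAEDeriv u v a b) :
    HasAEDeriv (fun x => f x - u x) (fun x => g x - v x) a b := by
  refine ⟨H.ac.sub K.ac, ?_⟩
  filter_upwards [H.ae, K.ae] with x h1 h2 h3 using (h1 h3).sub (h2 h3)

theorem mul (H : HasAEDeriv f g a b) (K : HasAEDeriv u v a b) :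
    HasAEDeriv (fun x => f x * u x) (fun x => g x * u x + f x * v x) a b := by
  refine ⟨H.ac.mul K.ac, ?_⟩
  filter_upwards [H.ae, K.ae] with x h1 h2 h3 using (h1 h3).mul (h2 h3)

theorem const_mul (k : ℝ) (H : HasAEDeriv f g a b) :
    HasAEDeriv (fun x => k * f x) (fun x => k * g x) a b := by
  refine ⟨H.ac.const_mul k, ?_⟩
  filter_upwards [H.ae] with x h1 h3 using (h1 h3).const_mul k

theorem comp {h h' : ℝ → ℝ} (hh : ∀ y, HasDerivAt h (h' y) y) (hc : Continuous h')
    (H : HasAEDeriv f g a b) : HasAEDeriv (fun x => h (f x)) (fun x => h' (f x) * g x) a b := by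
  refine ⟨absolutelyContinuousOnInterval_comp H.ac hh hc, ?_⟩
  filter_upwards [H.ae] with x h1 h3 using (hh (f x)).comp x (h1 h3)

theorem integral_eq (hab : a ≤ b) (H : HasAEDeriv f g a b) : ∫ x in a..b, g x = f b - f a := by
  rw [← H.ac.integral_deriv_eq_sub]
  refine intervalIntegral.integral_congr_ae ?_
  rw [uIoc_of_le hab]
  filter_upwards [ae_restrict_of_Ioo H.ae] with x h1 h2 using (h1 h2).deriv.symm

theorem of_integral (hab : a ≤ b) (hg : IntervalIntegrable g volume a b) (k : ℝ) :
    HasAEDeriv (fun x => k + ∫ t in a..x, g t) g a b := by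
  refine ⟨(const k).ac.add (hg.absolutelyContinuousOnInterval_intervalIntegral left_mem_uIcc), ?_⟩
  filter_upwards [hg.ae_hasDerivAt_integral] with x h1 h2
  rw [uIcc_of_le hab] at h1
  exact (h1 (Ioo_subset_Icc_self h2) a (left_mem_Icc.2 hab)).const_add k

theorem of_hasDerivAt (hab : a ≤ b) (hc : ContinuousOn f (Icc a b))
    (hd : ∀ x ∈ Ioo a b, HasDerivAt f (g x) x) (hg : ContinuousOn g (Icc a b)) :
    HasAEDeriv f g a b := by
  have hi : IntervalIntegrable g volume a b := by
    rw [← uIcc_of_le hab] at hg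
    exact hg.intervalIntegrable
  refine (of_integral hab hi (f a)).congr hab fun x hx => ?_
  have := intervalIntegral.integral_eq_sub_of_hasDerivAt_of_le hx.1
    (hc.mono (Icc_subset_Icc le_rfl hx.2)) (fun y hy => hd y ⟨hy.1, hy.2.trans_le hx.2⟩)
    (hi.mono_set (by rw [uIcc_of_le hab, uIcc_of_le hx.1]; exact Icc_subset_Icc le_rfl hx.2))
  linarith

/-- `f` is a primitive of `g`, so continuity of `g` upgrades the almost everywhere derivative to a
classical one. This recovers `u'` pointwise from the integrated system. -/
theorem hasDerivAt_of_continuousOn (H : HasAEDeriv f g a b) (hg : ContinuousOn g (Icc a b))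
    {x : ℝ} (hx : x ∈ Ioo a b) : HasDerivAt f (g x) x := by
  have hab : a ≤ b := (hx.1.trans hx.2).le
  have e : f =ᶠ[𝓝 x] fun y => f a + ∫ t in a..y, g t := by
    filter_upwards [isOpen_Ioo.mem_nhds hx] with y hy
    rw [(H.mono le_rfl hy.1.le hy.2.le).integral_eq hy.1.le]
    ring
  refine HasDerivAt.congr_of_eventuallyEq ?_ e
  have hi : IntervalIntegrable g volume a x := by
    refine ContinuousOn.intervalIntegrable ?_
    rw [uIcc_of_le hx.1.le]
    exact hg.mono (Icc_subset_Icc le_rfl hx.2.le)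
  have ho : ContinuousOn g (Ioo a b) := hg.mono Ioo_subset_Icc_self
  exact (intervalIntegral.integral_hasDerivAt_right hi
    (ho.stronglyMeasurableAtFilter isOpen_Ioo x hx)
    (ho.continuousAt (isOpen_Ioo.mem_nhds hx))).const_add (f a)

theorem le_of_nonneg (hab : a ≤ b) (H : HasAEDeriv f g a b)
    (h : ∀ᵐ x, x ∈ Ioo a b → 0 ≤ g x) : f a ≤ f b := by
  rw [← sub_nonneg, ← H.integral_eq hab, intervalIntegral.integral_of_le hab]
  refine integral_nonneg_of_ae ?_
  rw [EventuallyLE, ae_restrict_iff' measurableSet_Ioc]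
  exact ae_restrict_of_Ioo h

/-- Gronwall's inequality. -/
theorem exp_mul_le (hab : a ≤ b) {K : ℝ} (H : HasAEDeriv f g a b)
    (h : ∀ᵐ x, x ∈ Ioo a b → K * f x ≤ g x) : Real.exp (K * (b - a)) * f a ≤ f b := by
  have he : ∀ y, HasDerivAt (fun y => Real.exp (-K * y)) (Real.exp (-K * y) * -K) y := fun y => by
    simpa using ((hasDerivAt_id y).const_mul (-K)).exp
  have E := HasAEDeriv.comp he (by fun_prop) (HasAEDeriv.id (a := a) (b := b))
  have h2 := (E.mul H).le_of_nonneg hab (by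
    filter_upwards [h] with x h1 h2
    have := mul_le_mul_of_nonneg_left (h1 h2) (Real.exp_nonneg (-K * x))
    linarith)
  have h3 := mul_le_mul_of_nonneg_left h2 (Real.exp_nonneg (K * b))
  rw [← mul_assoc, ← mul_assoc, ← Real.exp_add, ← Real.exp_add] at h3
  have e1 : K * b + -K * a = K * (b - a) := by ring
  have e2 : K * b + -K * b = 0 := by ring
  rwa [e1, e2, Real.exp_zero, one_mul] at h3

/-- Squaring the negative part makes it `C¹`, so that the chain rule `comp` applies to it. -/
theorem hasDerivAt_min_sq (y : ℝ) : HasDerivAt (fun y : ℝ => (min y 0) ^ 2) (2 * min y 0) y := by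
  have hne : ∀ z : ℝ, z ≠ 0 → HasDerivAt (fun y : ℝ => (min y 0) ^ 2) (2 * min z 0) z := by
    intro z hz
    rcases lt_or_gt_of_ne hz with h | h
    · rw [min_eq_left h.le]
      have : HasDerivAt (fun y : ℝ => y ^ 2) (2 * z) z := by simpa using hasDerivAt_pow 2 z
      refine this.congr_of_eventuallyEq ?_
      filter_upwards [Iio_mem_nhds h] with w hw
      rw [min_eq_left (le_of_lt hw)]
    · rw [min_eq_right h.le, mul_zero]
      refine (hasDerivAt_const z (0 : ℝ)).congr_of_eventuallyEq ?_
      filter_upwards [Ioi_mem_nhds h] with w hw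
      rw [min_eq_right (le_of_lt hw)]
      norm_num
  rcases eq_or_ne y 0 with rfl | hy
  · exact hasDerivAt_of_hasDerivAt_of_ne (g := fun z => 2 * min z 0) hne (by fun_prop) (by fun_prop)
  · exact hne y hy

/-- The squared negative part `y` of `f` satisfies `y' ≤ 2 K y` and starts at `0`, so Gronwall keeps
it at `0`. -/
theorem nonneg_of_deriv_ge (hab : a ≤ b) {K : ℝ} (H : HasAEDeriv f g a b)
    (h : ∀ᵐ x, x ∈ Ioo a b → -K * |f x| ≤ g x) (ha : 0 ≤ f a) : 0 ≤ f b := by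
  have h1 := ((H.comp hasDerivAt_min_sq (by fun_prop)).const_mul (-1)).exp_mul_le (K := 2 * K) hab
    (by
      filter_upwards [h] with x hx hx'
      have := hx hx'
      rcases le_total (f x) 0 with h0 | h0
      · rw [min_eq_left h0]
        rw [abs_of_nonpos h0] at this
        nlinarith
      · rw [min_eq_right h0]
        simp)
  rw [min_eq_right ha] at h1
  have h2 : (min (f b) 0) ^ 2 = 0 := by nlinarith [sq_nonneg (min (f b) 0)]
  have h3 : min (f b) 0 = 0 := by simpa using h2
  exact min_eq_right_iff.1 h3

theorem exp_mul_le_of_deriv_ge (hab : a ≤ b) {K : ℝ} (H : HasAEDeriv f g a b)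
    (h : ∀ᵐ x, x ∈ Ioo a b → -K * |f x| ≤ g x) (ha : 0 ≤ f a) :
    Real.exp (-K * (b - a)) * f a ≤ f b := by
  refine H.exp_mul_le hab ?_
  filter_upwards [h] with x h1 h2
  have h3 : 0 ≤ f x := (H.mono le_rfl h2.1.le h2.2.le).nonneg_of_deriv_ge h2.1.le (K := K) (by
    filter_upwards [h] with y hy hy' using hy ⟨hy'.1, hy'.2.trans h2.2⟩) ha
  rw [abs_of_nonneg h3] at h1
  exact h1 h2

/-- `f²` satisfies `|(f²)'| ≤ 2 K f²`; Gronwall with either sign transports vanishing in both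
directions. -/
theorem eq_zero_iff_of_linear (hab : a ≤ b) {K : ℝ} {c : ℝ → ℝ} (H : HasAEDeriv f g a b)
    (h : ∀ᵐ x, x ∈ Ioo a b → g x = c x * f x) (hc : ∀ x, |c x| ≤ K) : f a = 0 ↔ f b = 0 := by
  have H2 := H.mul H
  constructor
  · intro h0
    have := (H2.const_mul (-1)).exp_mul_le (K := 2 * K) hab (by
      filter_upwards [h] with x h1 h2
      rw [h1 h2]
      nlinarith [abs_le.1 (hc x), mul_self_nonneg (f x)])
    rw [h0] at this
    have h2 : f b * f b = 0 := by nlinarith [mul_self_nonneg (f b)]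
    simpa using h2
  · intro h0
    have := H2.exp_mul_le (K := -(2 * K)) hab (by
      filter_upwards [h] with x h1 h2
      rw [h1 h2]
      nlinarith [abs_le.1 (hc x), mul_self_nonneg (f x)])
    rw [h0] at this
    have h2 : f a * f a ≤ 0 := by
      by_contra hh
      have := mul_pos (Real.exp_pos (-(2 * K) * (b - a))) (not_le.1 hh)
      linarith
    have h3 : f a * f a = 0 := le_antisymm h2 (mul_self_nonneg _)
    simpa using h3

end HasAEDeriv

/-! ### Existence by weighted Picard iteration -/

/-- Existence for scalar Carathéodory equations with a bounded, uniformly Lipschitz right-hand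
side. -/
theorem exists_hasAEDeriv {F : ℝ → ℝ → ℝ} {K C a b : ℝ} (hab : a ≤ b) (hK : 0 < K)
    (hm : ∀ θ : ℝ → ℝ, Continuous θ → Measurable fun x => F x (θ x))
    (hC : ∀ x y, |F x y| ≤ C) (hL : ∀ x y z, |F x y - F x z| ≤ K * |y - z|) (α : ℝ) :
    ∃ θ : ℝ → ℝ, θ a = α ∧ HasAEDeriv θ (fun x => F x (θ x)) a b := by
  -- Bielecki's weight: unknowns are written as `w · η`, and the Picard map conjugated by `w`
  -- contracts by `1/2` on the whole interval, however long it is.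
  let w : ℝ → ℝ := fun x => Real.exp (2 * K * (x - a))
  have hw : Continuous w := by fun_prop
  have hwpos : ∀ x, 0 < w x := fun x => Real.exp_pos _
  let ext : C(Icc a b, ℝ) → ℝ → ℝ := fun η x => w x * η (projIcc a b hab x)
  have hext : ∀ η, Continuous (ext η) := fun η => by
    have : Continuous fun x => η (projIcc a b hab x) := η.continuous.comp continuous_projIcc
    exact hw.mul this
  have hint : ∀ θ : ℝ → ℝ, Continuous θ → ∀ c d,
      IntervalIntegrable (fun x => F x (θ x)) volume c d := fun θ hθ c d => by
    rw [intervalIntegrable_iff]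
    exact Measure.integrableOn_of_bounded (M := C) (by simp) (hm θ hθ).aestronglyMeasurable
      (Eventually.of_forall fun x => hC _ _)
  have hprim : ∀ θ : ℝ → ℝ, Continuous θ → Continuous fun x => α + ∫ t in a..x, F t (θ t) :=
    fun θ hθ => continuous_const.add
      (intervalIntegral.continuous_primitive (fun c d => hint θ hθ c d) a)
  let T : C(Icc a b, ℝ) → C(Icc a b, ℝ) := fun η =>
    ⟨fun x => (w x)⁻¹ * (α + ∫ t in a..(x : ℝ), F t (ext η t)), by
      have h1 := hprim _ (hext η)
      have h2 : Continuous fun x => (w x)⁻¹ := hw.inv₀ fun x => (hwpos x).ne'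
      exact (h2.mul h1).comp continuous_subtype_val⟩
  have hT : ContractingWith (1 / 2) T := by
    refine ⟨by rw [div_lt_one] <;> norm_num, LipschitzWith.of_dist_le_mul fun η ζ => ?_⟩
    rw [ContinuousMap.dist_le (by positivity)]
    intro x
    have hx : a ≤ (x : ℝ) := x.2.1
    have e : dist (T η x) (T ζ x)
        = (w x)⁻¹ * |∫ t in a..(x : ℝ), (F t (ext η t) - F t (ext ζ t))| := by
      rw [intervalIntegral.integral_sub (hint _ (hext η) _ _) (hint _ (hext ζ) _ _), Real.dist_eq]
      change |(w x)⁻¹ * _ - (w x)⁻¹ * _| = _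
      rw [← mul_sub, abs_mul, abs_of_pos (inv_pos.2 (hwpos x))]
      congr 2
      ring
    have b1 : |∫ t in a..(x : ℝ), (F t (ext η t) - F t (ext ζ t))|
        ≤ ∫ t in a..(x : ℝ), K * dist η ζ * w t := by
      rw [← Real.norm_eq_abs]
      refine intervalIntegral.norm_integral_le_of_norm_le hx (Eventually.of_forall fun t _ => ?_)
        ((continuous_const.mul hw).intervalIntegrable _ _)
      refine (hL _ _ _).trans ?_
      have : |ext η t - ext ζ t| ≤ dist η ζ * w t := by
        change |w t * _ - w t * _| ≤ _
        rw [← mul_sub, abs_mul, abs_of_pos (hwpos t), mul_comm]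
        exact mul_le_mul_of_nonneg_right
          (by simpa [Real.dist_eq] using ContinuousMap.dist_apply_le_dist (f := η) (g := ζ) _)
          (hwpos t).le
      calc K * |ext η t - ext ζ t| ≤ K * (dist η ζ * w t) := mul_le_mul_of_nonneg_left this hK.le
        _ = _ := by ring
    have b2 : ∫ t in a..(x : ℝ), w t = (w x - 1) / (2 * K) := by
      have hd : ∀ t ∈ uIcc a (x : ℝ), HasDerivAt (fun t => w t / (2 * K)) (w t) t := fun t _ => by
        have h1 : HasDerivAt (fun t : ℝ => 2 * K * (t - a)) (2 * K) t := by
          simpa using ((hasDerivAt_id t).sub_const a).const_mul (2 * K)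
        have := h1.exp.div_const (2 * K)
        rwa [mul_div_cancel_right₀ _ (by positivity)] at this
      rw [intervalIntegral.integral_eq_sub_of_hasDerivAt hd (hw.intervalIntegrable _ _)]
      have : w a = 1 := by simp [w]
      rw [this]
      ring
    rw [intervalIntegral.integral_const_mul, b2] at b1
    rw [e]
    have h3 : K * dist η ζ * ((w x - 1) / (2 * K)) ≤ (1 / 2 * dist η ζ) * w x := by
      have : K * dist η ζ * ((w x - 1) / (2 * K)) = 1 / 2 * dist η ζ * (w x - 1) := by
        field_simp
      rw [this]
      have : 0 ≤ dist η ζ := dist_nonneg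
      nlinarith
    rw [inv_mul_le_iff₀ (hwpos x), mul_comm (w x)]
    push_cast
    exact b1.trans h3
  let η := hT.fixedPoint T
  have hη : T η = η := hT.fixedPoint_isFixedPt
  have key : ∀ x ∈ Icc a b, α + ∫ t in a..x, F t (ext η t) = ext η x := fun x hx => by
    change _ = w x * η (projIcc a b hab x)
    rw [projIcc_of_mem hab hx]
    conv_rhs => rw [← hη]
    change _ = w x * ((w x)⁻¹ * _)
    rw [mul_inv_cancel_left₀ (hwpos x).ne']
  refine ⟨ext η, by rw [← key a (left_mem_Icc.2 hab)]; simp, ?_⟩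
  exact (HasAEDeriv.of_integral hab (hint _ (hext η) a b) α).congr hab key

/-! ### The Prüfer angle equation and comparison of its solutions -/

/-- The coefficients are bounded measurable functions. -/
structure BddMeas (B : ℝ → ℝ) : Prop where
  measurable : Measurable B
  bdd : ∃ M, ∀ x, |B x| ≤ M

theorem BddMeas.const (c : ℝ) : BddMeas fun _ => c := ⟨measurable_const, |c|, fun _ => le_rfl⟩

theorem BddMeas.const_sub {q : ℝ → ℝ} (hq : BddMeas q) (t : ℝ) : BddMeas fun x => t - q x := by
  obtain ⟨M, hM⟩ := hq.bdd
  exact ⟨measurable_const.sub hq.measurable, |t| + M,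
    fun x => (abs_sub _ _).trans (add_le_add le_rfl (hM x))⟩

/-- The right-hand side of the equation of the Prüfer angle of `u' = A v`, `v' = - B u`. -/
noncomputable def angleField (A : ℝ) (B : ℝ → ℝ) (x y : ℝ) : ℝ :=
  A * Real.cos y ^ 2 + B x * Real.sin y ^ 2

/-- The product form gives at once the Lipschitz bound and the `π`-periodicity of the field in the
angle. -/
theorem angleField_sub (A : ℝ) (B : ℝ → ℝ) (x y z : ℝ) : angleField A B x y - angleField A B x z
    = (B x - A) * (Real.sin (y - z) * Real.sin (y + z)) := by
  have hy := Real.sin_sq_add_cos_sq y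
  have hz := Real.sin_sq_add_cos_sq z
  have e : Real.sin (y - z) * Real.sin (y + z) = Real.sin y ^ 2 - Real.sin z ^ 2 := by
    rw [Real.sin_sub, Real.sin_add]
    linear_combination Real.sin y ^ 2 * hz - Real.sin z ^ 2 * hy
  rw [e]
  unfold angleField
  linear_combination A * hy - A * hz

theorem abs_angleField_sub_le {A : ℝ} {B : ℝ → ℝ} {M : ℝ} (hM : ∀ x, |B x| ≤ M) (x y z : ℝ) :
    |angleField A B x y - angleField A B x z| ≤ (M + |A|) * |y - z| := by
  rw [angleField_sub, abs_mul, abs_mul]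
  have h1 : |B x - A| ≤ M + |A| := (abs_sub _ _).trans (add_le_add (hM x) le_rfl)
  have h2 : |Real.sin (y - z)| ≤ |y - z| := Real.abs_sin_le_abs
  have h3 : |Real.sin (y + z)| ≤ 1 := Real.abs_sin_le_one _
  have h4 : |Real.sin (y - z)| * |Real.sin (y + z)| ≤ |y - z| := by
    nlinarith [abs_nonneg (Real.sin (y - z)), abs_nonneg (Real.sin (y + z))]
  exact mul_le_mul h1 h4 (by positivity) ((abs_nonneg _).trans h1)

theorem angleField_add_int_mul_pi (A : ℝ) (B : ℝ → ℝ) (x y : ℝ) (n : ℤ) :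
    angleField A B x (y + n * Real.pi) = angleField A B x y := by
  have := angleField_sub A B x (y + n * Real.pi) y
  rw [add_sub_cancel_left, Real.sin_int_mul_pi] at this
  linarith

theorem angleField_int_mul_pi (A : ℝ) (B : ℝ → ℝ) (x : ℝ) (n : ℤ) :
    angleField A B x (n * Real.pi) = A := by
  have := angleField_add_int_mul_pi A B x 0 n
  simpa [angleField] using this

/-- `θ` is a Prüfer angle on `[a, b]`. -/
def IsAngle (A : ℝ) (B : ℝ → ℝ) (a b : ℝ) (θ : ℝ → ℝ) : Prop :=
  HasAEDeriv θ (fun x => angleField A B x (θ x)) a b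

theorem exists_isAngle (A : ℝ) {B : ℝ → ℝ} (hB : BddMeas B) {a b : ℝ} (hab : a ≤ b) (α : ℝ) :
    ∃ θ, θ a = α ∧ IsAngle A B a b θ := by
  obtain ⟨M, hM⟩ := hB.bdd
  have hM0 : 0 ≤ M := (abs_nonneg _).trans (hM 0)
  refine exists_hasAEDeriv (F := angleField A B) (K := M + |A| + 1) (C := |A| + M) hab
    (by positivity) (fun θ hθ => ?_) (fun x y => ?_) (fun x y z => ?_) α
  · have := hB.measurable
    have := hθ.measurable
    unfold angleField
    fun_prop
  · unfold angleField
    have h1 := Real.cos_sq_le_one y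
    have h2 := Real.sin_sq_le_one y
    refine (abs_add_le _ _).trans (add_le_add ?_ ?_)
    · rw [abs_mul, abs_of_nonneg (sq_nonneg (Real.cos y))]
      nlinarith [abs_nonneg A]
    · rw [abs_mul, abs_of_nonneg (sq_nonneg (Real.sin y))]
      nlinarith [abs_nonneg (B x), hM x]
  · refine (abs_angleField_sub_le hM x y z).trans ?_
    nlinarith [abs_nonneg (y - z)]

/-- A supersolution stays above a subsolution. -/
theorem exp_mul_sub_le {A : ℝ} {B : ℝ → ℝ} {M : ℝ} (hM : ∀ x, |B x| ≤ M) {a b : ℝ} (hab : a ≤ b)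
    {θ ψ g h : ℝ → ℝ} (hθ : HasAEDeriv θ g a b) (hψ : HasAEDeriv ψ h a b)
    (hg : ∀ x ∈ Ioo a b, g x ≤ angleField A B x (θ x))
    (hh : ∀ x ∈ Ioo a b, angleField A B x (ψ x) ≤ h x) (h0 : θ a ≤ ψ a) :
    Real.exp (-(M + |A|) * (b - a)) * (ψ a - θ a) ≤ ψ b - θ b := by
  -- By the Lipschitz bound `ψ - θ` has derivative at least `-(M + |A|) |ψ - θ|`. The exponential
  -- factor preserves strict inequalities.
  refine (hψ.sub hθ).exp_mul_le_of_deriv_ge hab (Eventually.of_forall fun x hx => ?_)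
    (sub_nonneg.2 h0)
  have := abs_angleField_sub_le (A := A) hM x (ψ x) (θ x)
  have := neg_abs_le (angleField A B x (ψ x) - angleField A B x (θ x))
  have := hg x hx
  have := hh x hx
  linarith

theorem le_of_subsolution_of_supersolution {A : ℝ} {B : ℝ → ℝ} (hB : BddMeas B) {a b : ℝ}
    (hab : a ≤ b) {θ ψ g h : ℝ → ℝ} (hθ : HasAEDeriv θ g a b) (hψ : HasAEDeriv ψ h a b)
    (hg : ∀ x ∈ Ioo a b, g x ≤ angleField A B x (θ x))
    (hh : ∀ x ∈ Ioo a b, angleField A B x (ψ x) ≤ h x) (h0 : θ a ≤ ψ a) : θ b ≤ ψ b := by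
  obtain ⟨M, hM⟩ := hB.bdd
  have := exp_mul_sub_le hM hab hθ hψ hg hh h0
  have := mul_nonneg (Real.exp_nonneg (-(M + |A|) * (b - a))) (sub_nonneg.2 h0)
  linarith

theorem lt_of_subsolution_of_supersolution {A : ℝ} {B : ℝ → ℝ} (hB : BddMeas B) {a b : ℝ}
    (hab : a ≤ b) {θ ψ g h : ℝ → ℝ} (hθ : HasAEDeriv θ g a b) (hψ : HasAEDeriv ψ h a b)
    (hg : ∀ x ∈ Ioo a b, g x ≤ angleField A B x (θ x))
    (hh : ∀ x ∈ Ioo a b, angleField A B x (ψ x) ≤ h x) (h0 : θ a < ψ a) : θ b < ψ b := by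
  obtain ⟨M, hM⟩ := hB.bdd
  have := exp_mul_sub_le hM hab hθ hψ hg hh h0.le
  have := mul_pos (Real.exp_pos (-(M + |A|) * (b - a))) (sub_pos.2 h0)
  linarith

theorem angleField_mono {B B' : ℝ → ℝ} (A : ℝ) {x : ℝ} (h : B x ≤ B' x) (y : ℝ) :
    angleField A B x y ≤ angleField A B' x y :=
  add_le_add le_rfl (mul_le_mul_of_nonneg_right h (sq_nonneg _))

theorem IsAngle.mono {A : ℝ} {B : ℝ → ℝ} {a b c d : ℝ} {θ : ℝ → ℝ} (h : IsAngle A B a b θ)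
    (hac : a ≤ c) (hcd : c ≤ d) (hdb : d ≤ b) : IsAngle A B c d θ :=
  HasAEDeriv.mono h hac hcd hdb

theorem IsAngle.continuousOn {A : ℝ} {B : ℝ → ℝ} {a b : ℝ} {θ : ℝ → ℝ} (h : IsAngle A B a b θ)
    (hab : a ≤ b) : ContinuousOn θ (Icc a b) :=
  HasAEDeriv.continuousOn hab h

theorem IsAngle.add_int_mul_pi {A : ℝ} {B : ℝ → ℝ} {a b : ℝ} {θ : ℝ → ℝ} (h : IsAngle A B a b θ)
    (n : ℤ) : IsAngle A B a b fun x => θ x + n * Real.pi := by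
  refine (HasAEDeriv.add h (HasAEDeriv.const (n * Real.pi))).congr_deriv
    (Eventually.of_forall fun x _ => ?_)
  rw [angleField_add_int_mul_pi, add_zero]

/-! ### The flow map of the angle equation -/

open Classical in
/-- The value at `b` of the Prüfer angle with value `α` at `a`. -/
noncomputable def flow (A : ℝ) (B : ℝ → ℝ) (a b α : ℝ) : ℝ :=
  if h : ∃ θ, θ a = α ∧ IsAngle A B a b θ then h.choose b else 0

section flow

variable {A : ℝ} {B B' : ℝ → ℝ} {a b : ℝ}

theorem IsAngle.flow_eq (hB : BddMeas B) (hab : a ≤ b) {θ : ℝ → ℝ} (h : IsAngle A B a b θ) :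
    flow A B a b (θ a) = θ b := by
  have hex : ∃ ψ, ψ a = θ a ∧ IsAngle A B a b ψ := ⟨θ, rfl, h⟩
  rw [flow, dif_pos hex]
  obtain ⟨h1, h2⟩ := hex.choose_spec
  exact le_antisymm
    (le_of_subsolution_of_supersolution hB hab h2 h (fun _ _ => le_rfl) (fun _ _ => le_rfl) h1.le)
    (le_of_subsolution_of_supersolution hB hab h h2 (fun _ _ => le_rfl) (fun _ _ => le_rfl) h1.ge)

theorem flow_mono (hB : BddMeas B) (hB' : BddMeas B') (hab : a ≤ b)
    (h : ∀ x, B x ≤ B' x) {α β : ℝ} (hα : α ≤ β) : flow A B a b α ≤ flow A B' a b β := by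
  obtain ⟨θ, rfl, hθ⟩ := exists_isAngle A hB hab α
  obtain ⟨ψ, rfl, hψ⟩ := exists_isAngle A hB' hab β
  rw [hθ.flow_eq hB hab, hψ.flow_eq hB' hab]
  exact le_of_subsolution_of_supersolution hB hab hθ hψ (fun _ _ => le_rfl)
    (fun x _ => angleField_mono A (h x) _) hα

theorem flow_strictMono (hB : BddMeas B) (hab : a ≤ b) : StrictMono (flow A B a b) := by
  intro α β hα
  obtain ⟨θ, rfl, hθ⟩ := exists_isAngle A hB hab α
  obtain ⟨ψ, rfl, hψ⟩ := exists_isAngle A hB hab β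
  rw [hθ.flow_eq hB hab, hψ.flow_eq hB hab]
  exact lt_of_subsolution_of_supersolution hB hab hθ hψ (fun _ _ => le_rfl) (fun _ _ => le_rfl) hα

theorem flow_add_int_mul_pi (hB : BddMeas B) (hab : a ≤ b) (α : ℝ) (n : ℤ) :
    flow A B a b (α + n * Real.pi) = flow A B a b α + n * Real.pi := by
  obtain ⟨θ, rfl, hθ⟩ := exists_isAngle A hB hab α
  rw [hθ.flow_eq hB hab, ← (hθ.add_int_mul_pi n).flow_eq hB hab]

/-- For `A = 0` the field vanishes at multiples of `π`, which are therefore constant solutions. -/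
theorem flow_zero_int_mul_pi (hB : BddMeas B) (hab : a ≤ b) (n : ℤ) :
    flow 0 B a b (n * Real.pi) = n * Real.pi := by
  have : IsAngle 0 B a b fun _ => (n : ℝ) * Real.pi :=
    (HasAEDeriv.const (n * Real.pi)).congr_deriv
      (Eventually.of_forall fun x _ => by rw [angleField_int_mul_pi])
  exact this.flow_eq hB hab

/-- Continuous dependence on the initial value and on the coefficient. -/
theorem flow_sub_flow_le {M : ℝ} (hB : BddMeas B) (hM : ∀ x, |B x| ≤ M) (hB' : BddMeas B')
    (hab : a ≤ b) {ε : ℝ} (hε : 0 ≤ ε) (h : ∀ x, B x ≤ B' x) (h' : ∀ x, B' x ≤ B x + ε) {α β : ℝ}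
    (hα : α ≤ β) : flow A B' a b β - flow A B a b α
      ≤ Real.exp ((M + |A| + 1) * (b - a)) * (β - α + ε) := by
  obtain ⟨θ, rfl, hθ⟩ := exists_isAngle A hB hab α
  obtain ⟨ψ, rfl, hψ⟩ := exists_isAngle A hB' hab β
  rw [hθ.flow_eq hB hab, hψ.flow_eq hB' hab]
  have hM0 : 0 ≤ M := (abs_nonneg _).trans (hM 0)
  -- Gronwall is applied to `-(ψ - θ + ε)`: adding `ε` absorbs the inhomogeneous term, at the price
  -- of the `+ 1` in the rate.
  have := (((HasAEDeriv.sub hψ hθ).add (HasAEDeriv.const ε)).const_mul (-1)).exp_mul_le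
    (K := M + |A| + 1) hab (Eventually.of_forall fun x hx => ?_)
  · linarith
  have hle : θ x ≤ ψ x := le_of_subsolution_of_supersolution hB hx.1.le
    (HasAEDeriv.mono hθ le_rfl hx.1.le hx.2.le) (HasAEDeriv.mono hψ le_rfl hx.1.le hx.2.le)
    (fun _ _ => le_rfl) (fun x _ => angleField_mono A (h x) _) hα
  have h1 := (le_abs_self _).trans (abs_angleField_sub_le (A := A) hM x (ψ x) (θ x))
  rw [abs_of_nonneg (sub_nonneg.2 hle)] at h1
  have h2 : angleField A B' x (ψ x) ≤ angleField A B x (ψ x) + ε := by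
    unfold angleField
    have h3 := Real.sin_sq_le_one (ψ x)
    have h4 := mul_le_mul_of_nonneg_right (h' x) (sq_nonneg (Real.sin (ψ x)))
    nlinarith
  have h3 : 0 ≤ (M + |A|) * ε := by positivity
  linarith

theorem continuous_flow (hB : BddMeas B) (hab : a ≤ b) : Continuous (flow A B a b) := by
  obtain ⟨M, hM⟩ := hB.bdd
  have hlip : ∀ α β : ℝ, α ≤ β → |flow A B a b α - flow A B a b β|
      ≤ Real.exp ((M + |A| + 1) * (b - a)) * |α - β| := fun α β h => by
    rw [abs_sub_comm, abs_of_nonneg (sub_nonneg.2 ((flow_strictMono hB hab).monotone h)),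
      abs_sub_comm α, abs_of_nonneg (sub_nonneg.2 h)]
    simpa using flow_sub_flow_le (A := A) hB hM hB hab le_rfl (fun _ => le_rfl)
      (fun _ => by simp) h
  refine (LipschitzWith.of_dist_le_mul (K := ⟨_, Real.exp_nonneg ((M + |A| + 1) * (b - a))⟩)
    fun α β => ?_).continuous
  rw [Real.dist_eq, Real.dist_eq]
  rcases le_total α β with h | h
  · exact hlip α β h
  · rw [abs_sub_comm, abs_sub_comm α]
    exact hlip β α h

/-- The Prüfer angle crosses the multiples of `π` upwards. -/
theorem IsAngle.int_mul_pi_lt (hB : BddMeas B) (hab : a < b) {θ : ℝ → ℝ} (hθ : IsAngle 1 B a b θ)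
    {n : ℤ} (hn : n * Real.pi ≤ θ a) : n * Real.pi < θ b := by
  obtain ⟨M, hM⟩ := hB.bdd
  have hM0 : 0 ≤ M := (abs_nonneg _).trans (hM 0)
  -- The line `n π + κ (x - a)` is a subsolution: the field equals `1` at `n π`, and `κ` solves `κ =
  -- 1 - (M + 1) κ (b - a)`, which bounds the field from below along the line.
  let κ : ℝ := 1 / (1 + (M + 1) * (b - a))
  have hd : 0 < 1 + (M + 1) * (b - a) := by nlinarith
  have hκ : 0 < κ := by positivity
  have e : κ * (1 + (M + 1) * (b - a)) = 1 := one_div_mul_cancel hd.ne'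
  have hψ : HasAEDeriv (fun x => n * Real.pi + κ * (x - a)) (fun _ => κ) a b := by
    have := (HasAEDeriv.const (n * Real.pi)).add
      (((HasAEDeriv.id (a := a) (b := b)).sub (HasAEDeriv.const a)).const_mul κ)
    exact this.congr_deriv (Eventually.of_forall fun x _ => by simp)
  have := le_of_subsolution_of_supersolution (A := 1) hB hab.le hψ hθ (fun x hx => ?_)
    (fun _ _ => le_rfl) (by simpa using hn)
  · have := mul_pos hκ (sub_pos.2 hab)
    linarith
  have h1 := abs_angleField_sub_le (A := 1) hM x (n * Real.pi + κ * (x - a)) (n * Real.pi)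
  rw [angleField_int_mul_pi, add_sub_cancel_left, abs_one,
    abs_of_nonneg (mul_nonneg hκ.le (sub_nonneg.2 hx.1.le))] at h1
  have h2 := neg_le_of_abs_le h1
  have h3 : κ * (x - a) ≤ κ * (b - a) := by nlinarith [hx.2]
  have h4 : (M + 1) * (κ * (x - a)) ≤ (M + 1) * (κ * (b - a)) :=
    mul_le_mul_of_nonneg_left h3 (by linarith)
  nlinarith

theorem int_mul_pi_lt_flow (hB : BddMeas B) (hab : a < b) {α : ℝ}
    {n : ℤ} (hn : n * Real.pi ≤ α) : n * Real.pi < flow 1 B a b α := by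
  obtain ⟨θ, rfl, hθ⟩ := exists_isAngle 1 hB hab.le α
  rw [hθ.flow_eq hB hab.le]
  exact hθ.int_mul_pi_lt hB hab hn

/-- A large negative coefficient pushes the angle down to the next multiple of `π`. -/
theorem exists_flow_le (hA : 0 ≤ A) (hab : a < b) {α ε : ℝ} (hα : α < Real.pi) (hε : 0 < ε) :
    ∃ S : ℝ, ∀ B, BddMeas B → (∀ x, B x ≤ -S) → flow A B a b α ≤ ε := by
  wlog hε' : ε < Real.pi generalizing ε
  · obtain ⟨S, hS⟩ := this (half_pos Real.pi_pos) (by linarith [Real.pi_pos])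
    exact ⟨S, fun B hB h => (hS B hB h).trans (by linarith [Real.pi_pos])⟩
  let β := max α ε
  have hβ : β < Real.pi := max_lt hα hε'
  have hεβ : ε ≤ β := le_max_right _ _
  obtain ⟨m, hm0, hm⟩ : ∃ m, 0 < m ∧ ∀ y ∈ Icc ε β, m ≤ Real.sin y ^ 2 := by
    obtain ⟨y0, hy0, hmin⟩ := (isCompact_Icc (a := ε) (b := β)).exists_isMinOn
      (nonempty_Icc.2 hεβ) (f := fun y => Real.sin y ^ 2) (by fun_prop)
    exact ⟨_, pow_pos (Real.sin_pos_of_pos_of_lt_pi (hε.trans_le hy0.1) (hy0.2.trans_lt hβ)) 2,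
      fun y hy => hmin hy⟩
  let D := (β - ε) / (b - a)
  have hD : D * (b - a) = β - ε := div_mul_cancel₀ _ (sub_pos.2 hab).ne'
  have hD0 : 0 ≤ D := div_nonneg (by linarith) (by linarith)
  -- With this `S` the field is at most `A - (A + D) = -D` while the angle is in `[ε, β]`, so the
  -- line descending from `β` to `ε` with slope `-D` is a supersolution.
  refine ⟨(A + D) / m, fun B hB h => ?_⟩
  obtain ⟨θ, hθa, hθ⟩ := exists_isAngle A hB hab.le α
  have hψ : HasAEDeriv (fun x => β - D * (x - a)) (fun _ => -D) a b := by
    have := (HasAEDeriv.const β).sub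
      (((HasAEDeriv.id (a := a) (b := b)).sub (HasAEDeriv.const a)).const_mul D)
    exact this.congr_deriv (Eventually.of_forall fun x _ => by simp)
  have := le_of_subsolution_of_supersolution (A := A) hB hab.le hθ hψ (fun _ _ => le_rfl)
    (fun x hx => ?_) (by rw [hθa, sub_self, mul_zero, sub_zero]; exact le_max_left α ε)
  · rw [← hθa, hθ.flow_eq hB hab.le]
    linarith
  have h1 : β - D * (x - a) ∈ Icc ε β := by
    constructor <;> nlinarith [hx.1, hx.2]
  have h2 := hm _ h1
  have h3 : B x * Real.sin (β - D * (x - a)) ^ 2 ≤ -(A + D) := by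
    have h4 := mul_le_mul_of_nonneg_right (h x) (sq_nonneg (Real.sin (β - D * (x - a))))
    have h5 : (A + D) / m * m = A + D := div_mul_cancel₀ _ hm0.ne'
    have h6 : (A + D) / m * m ≤ (A + D) / m * Real.sin (β - D * (x - a)) ^ 2 :=
      mul_le_mul_of_nonneg_left h2 (by positivity)
    linarith
  have h7 := Real.cos_sq_le_one (β - D * (x - a))
  unfold angleField
  nlinarith

/-- The integral is the time in which `y' = 1 + T sin² y` climbs from `0` to `N`. The integrand is
dominated by `1` and tends to `0` off the zeros of the sine. -/
theorem tendsto_integral_inv (N : ℝ) : Tendsto (fun T : ℝ => ∫ y in (0 : ℝ)..N,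
    (1 + T * Real.sin y ^ 2)⁻¹) atTop (𝓝 0) := by
  have h0 : ∫ y in (0 : ℝ)..N, (0 : ℝ) = 0 := by simp
  suffices H : Tendsto (fun T : ℝ => ∫ y in (0 : ℝ)..N, (1 + T * Real.sin y ^ 2)⁻¹) atTop
      (𝓝 (∫ y in (0 : ℝ)..N, (0 : ℝ))) by rwa [h0] at H
  refine intervalIntegral.tendsto_integral_filter_of_dominated_convergence (fun _ => 1)
    ?_ ?_ (continuous_const.intervalIntegrable _ _) ?_
  · exact Eventually.of_forall fun T => (by fun_prop : Measurable fun y : ℝ =>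
      (1 + T * Real.sin y ^ 2)⁻¹).aestronglyMeasurable
  · filter_upwards [eventually_ge_atTop 0] with T hT
    refine Eventually.of_forall fun y _ => ?_
    have : 1 ≤ 1 + T * Real.sin y ^ 2 := by nlinarith [sq_nonneg (Real.sin y)]
    rw [Real.norm_eq_abs, abs_of_nonneg (by positivity)]
    exact inv_le_one_of_one_le₀ this
  · have hc : {y : ℝ | Real.sin y = 0}.Countable := by
      have : {y : ℝ | Real.sin y = 0} = range fun n : ℤ => (n : ℝ) * Real.pi := by
        ext y
        simp [Real.sin_eq_zero_iff]
      rw [this]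
      exact countable_range _
    filter_upwards [hc.ae_notMem volume] with y hy _
    have : 0 < Real.sin y ^ 2 :=
      lt_of_le_of_ne (sq_nonneg _) (Ne.symm (pow_ne_zero 2 hy))
    exact tendsto_inv_atTop_zero.comp
      (tendsto_atTop_add_const_left _ _ (tendsto_id.atTop_mul_const this))

/-- A large positive coefficient makes the angle large. -/
theorem exists_le_flow (hab : a < b) (N : ℝ) :
    ∃ T : ℝ, ∀ B, BddMeas B → (∀ x, T ≤ B x) → N ≤ flow 1 B a b 0 := by
  obtain ⟨T, hT0, hT⟩ := ((eventually_ge_atTop 0).and ((tendsto_integral_inv N).eventually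
    (gt_mem_nhds (sub_pos.2 hab)))).exists
  refine ⟨1 + T, fun B hB h => ?_⟩
  obtain ⟨θ, hθa, hθ⟩ := exists_isAngle 1 hB hab.le 0
  rw [← hθa, hθ.flow_eq hB hab.le]
  have hpos : ∀ y : ℝ, 0 < 1 + T * Real.sin y ^ 2 := fun y => by
    have := mul_nonneg hT0 (sq_nonneg (Real.sin y))
    linarith
  have hcont : Continuous fun y : ℝ => (1 + T * Real.sin y ^ 2)⁻¹ :=
    Continuous.inv₀ (by fun_prop) fun y => (hpos y).ne'
  -- `G` measures climbing time: since the field is at least `1 + T sin² θ`, `G (θ x) - x` is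
  -- nondecreasing, hence `G (θ b) ≥ b - a > G N`.
  let G : ℝ → ℝ := fun z => ∫ y in (0 : ℝ)..z, (1 + T * Real.sin y ^ 2)⁻¹
  have hG : ∀ z, HasDerivAt G (1 + T * Real.sin z ^ 2)⁻¹ z := fun z =>
    hcont.integral_hasStrictDerivAt 0 z |>.hasDerivAt
  have h1 := ((HasAEDeriv.comp hG hcont hθ).sub HasAEDeriv.id).le_of_nonneg hab.le
    (Eventually.of_forall fun x _ => by
      rw [sub_nonneg, inv_mul_eq_div, le_div_iff₀ (hpos _)]
      have h3 := mul_le_mul_of_nonneg_right (h x) (sq_nonneg (Real.sin (θ x)))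
      have h4 := Real.sin_sq_add_cos_sq (θ x)
      unfold angleField
      linarith)
  have h2 : G (θ a) = 0 := by simp [G, hθa]
  have hGm : StrictMono G := strictMono_of_hasDerivAt_pos hG fun z => inv_pos.2 (hpos z)
  refine (hGm.lt_iff_lt.1 ?_).le
  change G N < b - a at hT
  simp only [h2] at h1
  linarith

/-- An angle at a multiple of `π` strictly leaves it upwards, and by continuity takes values
strictly before the next multiple. -/
theorem IsAngle.exists_sin_ne_zero (hB : BddMeas B) (hab : a < b) {θ : ℝ → ℝ}
    (hθ : IsAngle 1 B a b θ) : ∃ x ∈ Ioo a b, Real.sin (θ x) ≠ 0 := by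
  by_contra! h
  have hc := hθ.continuousOn hab.le
  obtain ⟨c, hc1, hc2⟩ := exists_between hab
  obtain ⟨d, hd1, hd2⟩ := exists_between hc2
  obtain ⟨n, hn⟩ := Real.sin_eq_zero_iff.1 (h c ⟨hc1, hc2⟩)
  have hlt : n * Real.pi < θ d :=
    (hθ.mono hc1.le hd1.le hd2.le).int_mul_pi_lt hB hd1 hn.le
  have hy : ∃ y, n * Real.pi < y ∧ y < θ d ∧ y < n * Real.pi + Real.pi := by
    obtain ⟨y, h1, h2⟩ := exists_between (lt_min hlt (lt_add_of_pos_right _ Real.pi_pos))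
    exact ⟨y, h1, (lt_min_iff.1 h2).1, (lt_min_iff.1 h2).2⟩
  obtain ⟨y, h1, h2, h3⟩ := hy
  obtain ⟨x, hx, rfl⟩ := intermediate_value_Icc hd1.le (hc.mono (Icc_subset_Icc hc1.le hd2.le))
    ⟨hn ▸ h1.le, h2.le⟩
  have h4 := h x ⟨hc1.trans_le hx.1, hx.2.trans_lt hd2⟩
  have h5 : 0 < Real.sin (θ x - n * Real.pi) :=
    Real.sin_pos_of_pos_of_lt_pi (by linarith) (by linarith)
  rw [Real.sin_sub_int_mul_pi, h4] at h5
  simp at h5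

/-- If the end values agreed, the exponential lower bound for `ψ - θ` would force `θ = ψ`
throughout. Comparing derivatives then gives `ε sin² θ = 0` almost everywhere, hence everywhere by
continuity, which is impossible. -/
theorem flow_lt_flow (hB : BddMeas B) (hab : a < b) {α ε : ℝ} (hε : 0 < ε) (hB' : BddMeas B')
    (h : ∀ x, B' x = B x + ε) : flow 1 B a b α < flow 1 B' a b α := by
  obtain ⟨θ, hθa, hθ⟩ := exists_isAngle 1 hB hab.le α
  obtain ⟨ψ, hψa, hψ⟩ := exists_isAngle 1 hB' hab.le α
  have e1 := hθ.flow_eq hB hab.le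
  have e2 := hψ.flow_eq hB' hab.le
  rw [hθa] at e1
  rw [hψa] at e2
  rw [e1, e2]
  obtain ⟨M, hM⟩ := hB.bdd
  have hBB : ∀ x, B x ≤ B' x := fun x => by rw [h]; linarith
  have hle : ∀ x ∈ Icc a b, θ x ≤ ψ x := fun x hx => le_of_subsolution_of_supersolution hB hx.1
    (HasAEDeriv.mono hθ le_rfl hx.1 hx.2) (HasAEDeriv.mono hψ le_rfl hx.1 hx.2)
    (fun _ _ => le_rfl) (fun x _ => angleField_mono 1 (hBB x) _) (by rw [hθa, hψa])
  refine lt_of_le_of_ne (hle b (right_mem_Icc.2 hab.le)) fun heq => ?_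
  have heq' : ∀ x ∈ Icc a b, θ x = ψ x := fun x hx => by
    have := exp_mul_sub_le hM hx.2 (HasAEDeriv.mono hθ hx.1 hx.2 le_rfl)
      (HasAEDeriv.mono hψ hx.1 hx.2 le_rfl) (A := 1)
      (fun _ _ => le_rfl) (fun x _ => angleField_mono 1 (hBB x) _) (hle x hx)
    rw [heq, sub_self] at this
    have h2 := Real.exp_pos (-(M + |1|) * (b - x))
    have h3 : ψ x - θ x ≤ 0 := by
      by_contra h4
      have := mul_pos h2 (not_le.1 h4)
      linarith
    linarith [hle x hx]
  have hsin : ∀ᵐ x, x ∈ Ioo a b → Real.sin (θ x) = 0 := by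
    filter_upwards [hθ.ae, hψ.ae] with x h1 h2 hx
    have h3 : HasDerivAt θ (angleField 1 B' x (ψ x)) x := by
      refine (h2 hx).congr_of_eventuallyEq ?_
      filter_upwards [isOpen_Ioo.mem_nhds hx] with y hy using heq' y (Ioo_subset_Icc_self hy)
    have h4 := (h1 hx).unique h3
    rw [← heq' x (Ioo_subset_Icc_self hx)] at h4
    unfold angleField at h4
    rw [h x] at h4
    have h5 : ε * Real.sin (θ x) ^ 2 = 0 := by linarith
    simpa [hε.ne'] using h5
  have hcs : ContinuousOn (fun x => Real.sin (θ x)) (Ioo a b) :=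
    Real.continuous_sin.comp_continuousOn ((hθ.continuousOn hab.le).mono Ioo_subset_Icc_self)
  have hall : EqOn (fun x => Real.sin (θ x)) (fun _ => 0) (Ioo a b) :=
    Measure.eqOn_open_of_ae_eq ((ae_restrict_iff' measurableSet_Ioo).2 hsin) isOpen_Ioo hcs
      continuousOn_const
  obtain ⟨x, hx, hne⟩ := hθ.exists_sin_ne_zero hB hab
  exact hne (hall hx)

end flow

/-! ### The linear system in polar form -/

/-- The linear system `u' = A v`, `v' = - B u` on `[a, b]`. -/
structure LinSys (A : ℝ) (B u v : ℝ → ℝ) (a b : ℝ) : Prop where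
  left : HasAEDeriv u (fun x => A * v x) a b
  right : HasAEDeriv v (fun x => -(B x * u x)) a b

theorem LinSys.mono {A : ℝ} {B u v : ℝ → ℝ} {a b c d : ℝ} (h : LinSys A B u v a b)
    (hac : a ≤ c) (hcd : c ≤ d) (hdb : d ≤ b) : LinSys A B u v c d :=
  ⟨h.1.mono hac hcd hdb, h.2.mono hac hcd hdb⟩

theorem HasAEDeriv.sin {f g : ℝ → ℝ} {a b : ℝ} (h : HasAEDeriv f g a b) :
    HasAEDeriv (fun x => Real.sin (f x)) (fun x => Real.cos (f x) * g x) a b :=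
  h.comp Real.hasDerivAt_sin Real.continuous_cos

theorem HasAEDeriv.cos {f g : ℝ → ℝ} {a b : ℝ} (h : HasAEDeriv f g a b) :
    HasAEDeriv (fun x => Real.cos (f x)) (fun x => -Real.sin (f x) * g x) a b :=
  h.comp Real.hasDerivAt_cos (by fun_prop)

/-- Solutions of the linear system follow the Prüfer angle. -/
theorem LinSys.exists_polar {A : ℝ} {B u v θ : ℝ → ℝ} {a b r : ℝ} (hB : BddMeas B) (hab : a ≤ b)
    (h : LinSys A B u v a b) (hθ : IsAngle A B a b θ) (hu : u a = r * Real.sin (θ a))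
    (hv : v a = r * Real.cos (θ a)) :
    ∃ ρ ≠ 0, u b = ρ * r * Real.sin (θ b) ∧ v b = ρ * r * Real.cos (θ b) := by
  obtain ⟨M, hM⟩ := hB.bdd
  -- `w` and `s` are the components of `(u, v)` across and along the direction `(sin θ, cos θ)`. The
  -- first solves a homogeneous linear equation and so stays `0`; then so does the second, which
  -- therefore cannot become zero unless it starts at zero.
  let w : ℝ → ℝ := fun x => u x * Real.cos (θ x) - v x * Real.sin (θ x)
  let s : ℝ → ℝ := fun x => u x * Real.sin (θ x) + v x * Real.cos (θ x)
  let c : ℝ → ℝ := fun x => (B x - A) * (Real.sin (θ x) * Real.cos (θ x))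
  have hc : ∀ x, |c x| ≤ M + |A| := fun x => by
    have h1 : |B x - A| ≤ M + |A| := (abs_sub _ _).trans (add_le_add (hM x) le_rfl)
    have h2 : |Real.sin (θ x) * Real.cos (θ x)| ≤ 1 := by
      rw [abs_mul]
      exact mul_le_one₀ (Real.abs_sin_le_one _) (abs_nonneg _) (Real.abs_cos_le_one _)
    simp only [c]
    rw [abs_mul]
    nlinarith [abs_nonneg (B x - A), abs_nonneg (Real.sin (θ x) * Real.cos (θ x))]
  have hw : HasAEDeriv w (fun x => c x * w x) a b := by
    refine ((h.1.mul hθ.cos).sub (h.2.mul hθ.sin)).congr_deriv (Eventually.of_forall fun x _ => ?_)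
    have e := Real.sin_sq_add_cos_sq (θ x)
    simp only [w, c, angleField]
    generalize Real.sin (θ x) = S at e ⊢
    generalize Real.cos (θ x) = C at e ⊢
    linear_combination (-A * C * v x - B x * S * u x) * e
  have hwa : w a = 0 := by
    simp only [w]
    rw [hu, hv]
    ring
  have hw0 : ∀ x ∈ Icc a b, w x = 0 := fun x hx =>
    ((hw.mono le_rfl hx.1 hx.2).eq_zero_iff_of_linear hx.1 (Eventually.of_forall fun _ _ => rfl)
      hc).1 hwa
  have hs : HasAEDeriv s (fun x => -c x * s x) a b := by
    refine ((h.1.mul hθ.sin).add (h.2.mul hθ.cos)).congr_deriv (Eventually.of_forall fun x hx => ?_)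
    have e := Real.sin_sq_add_cos_sq (θ x)
    have e2 := hw0 x (Ioo_subset_Icc_self hx)
    simp only [s, c, w, angleField] at e2 ⊢
    generalize Real.sin (θ x) = S at e e2 ⊢
    generalize Real.cos (θ x) = C at e e2 ⊢
    linear_combination (A * C ^ 2 + B x * S ^ 2 - A * S ^ 2 - B x * C ^ 2) * e2
      + (-A * S * v x + B x * C * u x) * e
  have hsa : s a = r := by
    simp only [s]
    rw [hu, hv]
    linear_combination r * Real.sin_sq_add_cos_sq (θ a)
  have hub : u b = s b * Real.sin (θ b) ∧ v b = s b * Real.cos (θ b) := by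
    have e := Real.sin_sq_add_cos_sq (θ b)
    have e2 := hw0 b (right_mem_Icc.2 hab)
    simp only [s, w] at e2 ⊢
    constructor
    · linear_combination Real.cos (θ b) * e2 - u b * e
    · linear_combination -Real.sin (θ b) * e2 - v b * e
  have hiff := hs.eq_zero_iff_of_linear hab (Eventually.of_forall fun _ _ => rfl)
    (fun x => by rw [abs_neg]; exact hc x)
  rw [hsa] at hiff
  by_cases hr : r = 0
  · refine ⟨1, one_ne_zero, ?_⟩
    rw [hub.1, hub.2, hiff.1 hr, hr]
    simp
  · refine ⟨s b / r, div_ne_zero (fun h0 => hr (hiff.2 h0)) hr, ?_⟩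
    rwa [div_mul_cancel₀ _ hr]

theorem LinSys.exists_polar_flow {A : ℝ} {B u v : ℝ → ℝ} {a b r α : ℝ} (hB : BddMeas B)
    (hab : a ≤ b) (h : LinSys A B u v a b) (hu : u a = r * Real.sin α)
    (hv : v a = r * Real.cos α) : ∃ ρ ≠ 0, u b = ρ * r * Real.sin (flow A B a b α) ∧
      v b = ρ * r * Real.cos (flow A B a b α) := by
  obtain ⟨θ, rfl, hθ⟩ := exists_isAngle A hB hab α
  rw [hθ.flow_eq hB hab]
  exact h.exists_polar hB hab hθ hu hv

theorem exists_polar_coordinates (x y : ℝ) : ∃ r α : ℝ, x = r * Real.sin α ∧ y = r * Real.cos α :=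
  ⟨‖(⟨y, x⟩ : ℂ)‖, Complex.arg ⟨y, x⟩, by simp, by simp⟩

/-- Built from the angle: the amplitude is the exponential of the integral of `(1 - B) sin θ cos θ`.
-/
theorem exists_linSys {B : ℝ → ℝ} {a b : ℝ} (hB : BddMeas B) (hab : a ≤ b) (x₀ y₀ : ℝ) :
    ∃ u v, LinSys 1 B u v a b ∧ u a = x₀ ∧ v a = y₀ := by
  obtain ⟨r, α, rfl, rfl⟩ := exists_polar_coordinates x₀ y₀
  obtain ⟨θ, rfl, hθ⟩ := exists_isAngle 1 hB hab α
  obtain ⟨M, hM⟩ := hB.bdd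
  let c : ℝ → ℝ := fun x => (1 - B x) * (Real.sin (θ x) * Real.cos (θ x))
  have hc : IntervalIntegrable c volume a b := by
    refine IntervalIntegrable.mul_continuousOn ?_ ?_
    · rw [intervalIntegrable_iff]
      have hm := hB.measurable
      refine Measure.integrableOn_of_bounded (M := 1 + M) (by simp)
        (by fun_prop : Measurable fun x => 1 - B x).aestronglyMeasurable
        (Eventually.of_forall fun x => (abs_sub _ _).trans ?_)
      rw [abs_one]
      exact add_le_add le_rfl (hM x)
    · have := hθ.continuousOn hab
      rw [uIcc_of_le hab]
      fun_prop
  let s : ℝ → ℝ := fun x => r * Real.exp (0 + ∫ t in a..x, c t)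
  have hs : HasAEDeriv s (fun x => c x * s x) a b := by
    refine (((HasAEDeriv.of_integral hab hc 0).comp Real.hasDerivAt_exp
      Real.continuous_exp).const_mul r).congr_deriv (Eventually.of_forall fun x _ => ?_)
    simp only [s]
    ring
  have hsa : s a = r := by simp [s]
  refine ⟨fun x => s x * Real.sin (θ x), fun x => s x * Real.cos (θ x), ⟨?_, ?_⟩, ?_, ?_⟩
  · refine (hs.mul hθ.sin).congr_deriv (Eventually.of_forall fun x _ => ?_)
    have e := Real.sin_sq_add_cos_sq (θ x)
    simp only [c, angleField]
    generalize Real.sin (θ x) = S at e ⊢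
    generalize Real.cos (θ x) = C at e ⊢
    linear_combination s x * C * e
  · refine (hs.mul hθ.cos).congr_deriv (Eventually.of_forall fun x _ => ?_)
    have e := Real.sin_sq_add_cos_sq (θ x)
    simp only [c, angleField]
    generalize Real.sin (θ x) = S at e ⊢
    generalize Real.cos (θ x) = C at e ⊢
    linear_combination -s x * S * B x * e
  · simp only [hsa]
  · simp only [hsa]

/-! ### Jump conditions and one-sided derivatives -/

/-- The change of the Prüfer angle under the jump condition `u'(z+) - u'(z-) = σ u(z)`. -/
noncomputable def kick (σ : ℝ) : ℝ → ℝ := flow 0 (fun _ => -σ) 0 1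

/-- The jump is the time-one map of the system `u' = 0`, `v' = σ u`, so the kick inherits all
properties of flows. -/
theorem exists_polar_kick (σ : ℝ) {x y r α : ℝ} (hx : x = r * Real.sin α)
    (hy : y = r * Real.cos α) : ∃ ρ ≠ 0, x = ρ * r * Real.sin (kick σ α) ∧
      y + σ * x = ρ * r * Real.cos (kick σ α) := by
  have h : LinSys 0 (fun _ => -σ) (fun _ => x) (fun s => y + σ * x * s) 0 1 := by
    refine ⟨(HasAEDeriv.const x).congr_deriv (Eventually.of_forall fun _ _ => by simp), ?_⟩
    exact ((HasAEDeriv.const y).add (HasAEDeriv.id.const_mul (σ * x))).congr_deriv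
      (Eventually.of_forall fun _ _ => by ring)
  obtain ⟨ρ, hρ, h1, h2⟩ := h.exists_polar_flow (.const _) zero_le_one hx (by simpa using hy)
  exact ⟨ρ, hρ, h1, by simpa [kick] using h2⟩

theorem HasAEDeriv.hasDerivWithinAt_left {u v : ℝ → ℝ} {a b : ℝ} (hab : a < b)
    (h : HasAEDeriv u v a b) (hv : ContinuousOn v (Icc a b)) :
    HasDerivWithinAt u (v a) (Ioi a) a := by
  refine (hasDerivWithinAt_Ici_of_tendsto_deriv (s := Ioo a b)
    (fun x hx => (h.hasDerivAt_of_continuousOn hv hx).differentiableAt.differentiableWithinAt)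
    ((h.continuousOn hab.le a (left_mem_Icc.2 hab.le)).mono Ioo_subset_Icc_self)
    (Ioo_mem_nhdsGT hab) ?_).Ioi_of_Ici
  have h1 : Tendsto v (𝓝[>] a) (𝓝 (v a)) := by
    have := (hv a (left_mem_Icc.2 hab.le)).mono_left (nhdsWithin_mono _ Ioo_subset_Icc_self)
    rwa [nhdsWithin_Ioo_eq_nhdsGT hab] at this
  refine h1.congr' ?_
  filter_upwards [Ioo_mem_nhdsGT hab] with x hx using (h.hasDerivAt_of_continuousOn hv hx).deriv.symm

theorem HasAEDeriv.hasDerivWithinAt_right {u v : ℝ → ℝ} {a b : ℝ} (hab : a < b)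
    (h : HasAEDeriv u v a b) (hv : ContinuousOn v (Icc a b)) :
    HasDerivWithinAt u (v b) (Iio b) b := by
  refine (hasDerivWithinAt_Iic_of_tendsto_deriv (s := Ioo a b)
    (fun x hx => (h.hasDerivAt_of_continuousOn hv hx).differentiableAt.differentiableWithinAt)
    ((h.continuousOn hab.le b (right_mem_Icc.2 hab.le)).mono Ioo_subset_Icc_self)
    (Ioo_mem_nhdsLT hab) ?_).Iio_of_Iic
  have h1 : Tendsto v (𝓝[<] b) (𝓝 (v b)) := by
    have := (hv b (right_mem_Icc.2 hab.le)).mono_left (nhdsWithin_mono _ Ioo_subset_Icc_self)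
    rwa [nhdsWithin_Ioo_eq_nhdsLT hab] at this
  refine h1.congr' ?_
  filter_upwards [Ioo_mem_nhdsLT hab] with x hx using (h.hasDerivAt_of_continuousOn hv hx).deriv.symm

/-- A function in `H²` which is continuous up to the boundary comes from a linear system. -/
theorem IsH2On.exists_linSys {B u : ℝ → ℝ} {a b : ℝ} (hab : a < b)
    (h : IsH2On u (fun x => -(B x * u x)) a b) (hc : ContinuousOn u (Icc a b)) :
    ∃ v, LinSys 1 B u v a b ∧ ContinuousOn v (Icc a b) := by
  set g : ℝ → ℝ := fun x => -(B x * u x)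
  have hi : IntegrableOn g (Ioo a b) := h.memLp.integrable (by norm_num)
  have hii : IntervalIntegrable g volume a b := by
    rw [intervalIntegrable_iff, uIoc_of_le hab.le]
    rwa [integrableOn_Ioc_iff_integrableOn_Ioo]
  obtain ⟨m, hm⟩ := nonempty_Ioo.2 hab
  -- The constant makes `v` agree with `deriv u` at `m`, hence on all of `(a, b)`; unlike `deriv u`,
  -- `v` is continuous up to the end points.
  let v : ℝ → ℝ := fun x => (deriv u m - ∫ t in a..m, g t) + ∫ t in a..x, g t
  have hv : HasAEDeriv v g a b := HasAEDeriv.of_integral hab.le hii _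
  have hvc := hv.continuousOn hab.le
  have hd : ∀ x ∈ Ioo a b, HasDerivAt u (v x) x := fun x hx => by
    have h1 := (h.differentiableOn.differentiableAt (isOpen_Ioo.mem_nhds hx)).hasDerivAt
    have h2 := h.deriv_sub m hm x hx
    have hs : ∀ y ∈ Ioo a b, IntervalIntegrable g volume a y := fun y hy =>
      hii.mono_set (by
        rw [uIcc_of_le hab.le, uIcc_of_le hy.1.le]
        exact Icc_subset_Icc le_rfl hy.2.le)
    have h3 := intervalIntegral.integral_interval_sub_left (hs x hx) (hs m hm)
    have : v x = deriv u x := by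
      simp only [v]
      linarith
    rwa [this]
  refine ⟨v, ⟨?_, hv⟩, hvc⟩
  simp only [one_mul]
  exact HasAEDeriv.of_hasDerivAt hab.le hc hd hvc

theorem LinSys.hasAEDeriv {B u v : ℝ → ℝ} {a b : ℝ} (h : LinSys 1 B u v a b) :
    HasAEDeriv u v a b := by
  have := h.left
  simp only [one_mul] at this
  exact this

theorem LinSys.isH2On {B u v : ℝ → ℝ} {a b : ℝ} (hB : BddMeas B) (hab : a ≤ b)
    (h : LinSys 1 B u v a b) : IsH2On u (fun x => -(B x * u x)) a b := by
  have huc := h.left.continuousOn hab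
  have hvc := h.right.continuousOn hab
  have hd : ∀ x ∈ Ioo a b, HasDerivAt u (v x) x := fun x hx =>
    h.hasAEDeriv.hasDerivAt_of_continuousOn hvc hx
  refine ⟨?_, fun x hx => (hd x hx).differentiableAt.differentiableWithinAt, ?_⟩
  · obtain ⟨M, hM⟩ := hB.bdd
    obtain ⟨C, hC⟩ := isCompact_Icc.exists_bound_of_continuousOn huc
    refine MemLp.of_bound (C := M * C) ?_ ?_
    · exact (hB.measurable.aestronglyMeasurable.mul
        ((huc.mono Ioo_subset_Icc_self).aestronglyMeasurable measurableSet_Ioo)).neg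
    · refine (ae_restrict_iff' measurableSet_Ioo).2 (Eventually.of_forall fun x hx => ?_)
      rw [norm_neg, norm_mul]
      exact mul_le_mul (hM x) (hC x (Ioo_subset_Icc_self hx)) (norm_nonneg _)
        ((abs_nonneg _).trans (hM x))
  · have key : ∀ x ∈ Ioo a b, ∀ y ∈ Ioo a b, x ≤ y →
        deriv u y - deriv u x = ∫ t in x..y, -(B t * u t) := fun x hx y hy hxy => by
      rw [(hd x hx).deriv, (hd y hy).deriv, (h.right.mono hx.1.le hxy hy.2.le).integral_eq hxy]
    intro x hx y hy
    rcases le_total x y with hxy | hxy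
    · exact key x hx y hy hxy
    · rw [intervalIntegral.integral_symm, ← key y hy x hx hxy, neg_sub]

/-! ### Shooting through the point interactions -/

/-- The points of the list are increasing and lie between `a` and `ℓ`. -/
def Adm (ℓ : ℝ) : ℝ → List ℝ → Prop
  | a, [] => a < ℓ
  | a, z :: zs => a < z ∧ Adm ℓ z zs

theorem adm_of_pairwise {ℓ : ℝ} : ∀ {zs : List ℝ} {a : ℝ}, zs.Pairwise (· < ·) →
    (∀ z ∈ zs, a < z ∧ z < ℓ) → a < ℓ → Adm ℓ a zs
  | [], _, _, _, h => h
  | z :: zs, a, h1, h2, _ => by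
    rw [List.pairwise_cons] at h1
    have h3 := h2 z List.mem_cons_self
    exact ⟨h3.1, adm_of_pairwise h1.2
      (fun y hy => ⟨h1.1 y hy, (h2 y (List.mem_cons_of_mem _ hy)).2⟩) h3.2⟩

theorem adm_sort {ℓ : ℝ} (hℓ : 0 < ℓ) {Z : Finset ℝ} (hZ : (Z : Set ℝ) ⊆ Ioo 0 ℓ) :
    Adm ℓ 0 Z.sort :=
  adm_of_pairwise (Finset.sortedLT_sort Z).pairwise
    (fun _ hz => hZ (Finset.mem_coe.2 ((Finset.mem_sort _).1 hz))) hℓ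

theorem Adm.lt {ℓ : ℝ} : ∀ {zs : List ℝ} {a : ℝ}, Adm ℓ a zs → a < ℓ
  | [], _, h => h
  | _ :: _, _, h => h.1.trans h.2.lt

theorem Adm.lt_of_mem {ℓ : ℝ} : ∀ {zs : List ℝ} {a z : ℝ}, Adm ℓ a zs → z ∈ zs → a < z
  | y :: zs, a, z, h, hz => by
    rcases List.mem_cons.1 hz with rfl | hz
    · exact h.1
    · exact h.1.trans (h.2.lt_of_mem hz)

theorem Adm.mem_lt {ℓ : ℝ} : ∀ {zs : List ℝ} {a z : ℝ}, Adm ℓ a zs → z ∈ zs → z < ℓ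
  | y :: zs, a, z, h, hz => by
    rcases List.mem_cons.1 hz with rfl | hz
    · exact h.2.lt
    · exact h.2.mem_lt hz

/-- The value at `ℓ` of the Prüfer angle with value `α` at `a`, kicked at the points of the list. -/
noncomputable def angle (B : ℝ → ℝ) (ℓ σ : ℝ) : List ℝ → ℝ → ℝ → ℝ
  | [], a, α => flow 1 B a ℓ α
  | z :: zs, a, α => angle B ℓ σ zs z (kick σ (flow 1 B a z α))

theorem IsH2On.congr {u u' g g' : ℝ → ℝ} {a b : ℝ} (H : IsH2On u g a b)
    (hu : EqOn u u' (Ioo a b)) (hg : ∀ᵐ x, x ∈ Ioo a b → g x = g' x) : IsH2On u' g' a b := by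
  refine ⟨(memLp_congr_ae ((ae_restrict_iff' measurableSet_Ioo).2 hg)).1 H.memLp,
    H.differentiableOn.congr fun x hx => (hu hx).symm, fun x hx y hy => ?_⟩
  have hd : ∀ z ∈ Ioo a b, deriv u' z = deriv u z := fun z hz =>
    (hu.symm.eventuallyEq_of_mem (isOpen_Ioo.mem_nhds hz)).deriv_eq
  rw [hd x hx, hd y hy, H.deriv_sub x hx y hy]
  refine intervalIntegral.integral_congr_ae ?_
  filter_upwards [hg] with t h1 h2
  exact h1 ((convex_Ioo a b).ordConnected.uIcc_subset hx hy (uIoc_subset_uIcc h2))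

theorem IsH2On.mono {u g : ℝ → ℝ} {a b c d : ℝ} (H : IsH2On u g a b)
    (h : Ioo c d ⊆ Ioo a b) : IsH2On u g c d :=
  ⟨H.memLp.mono_measure (Measure.restrict_mono h le_rfl), H.differentiableOn.mono h,
    fun x hx y hy => H.deriv_sub x (h hx) y (h hy)⟩

/-- `u` solves `- u'' = B u` on `(a, ℓ)` with jump conditions at the points of the list. -/
structure SolvesOn (B : ℝ → ℝ) (ℓ σ : ℝ) (zs : List ℝ) (a : ℝ) (u : ℝ → ℝ) : Prop where
  continuousOn : ContinuousOn u (Icc a ℓ)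
  isH2On : ∀ c d, Ioo c d ⊆ Ioo a ℓ \ {x | x ∈ zs} → IsH2On u (fun x => -(B x * u x)) c d
  jump : ∀ z ∈ zs, ∃ p r : ℝ, HasDerivWithinAt u p (Iio z) z ∧
    HasDerivWithinAt u r (Ioi z) z ∧ r - p = σ * u z

variable {B : ℝ → ℝ} {ℓ σ : ℝ}

/-- The amplitude `r` may be `0` and is kept separate from the nonzero factor `ρ`, so that one
statement covers both the transport of the angle and uniqueness for zero initial data. -/
theorem exists_polar_of_isH2On {u : ℝ → ℝ} {a b p r α : ℝ} (hB : BddMeas B) (hab : a < b)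
    (h : IsH2On u (fun x => -(B x * u x)) a b) (hc : ContinuousOn u (Icc a b))
    (hp : HasDerivWithinAt u p (Ioi a) a) (hu : u a = r * Real.sin α) (hr : p = r * Real.cos α) :
    (∃ p', HasDerivWithinAt u p' (Iio b) b ∧ ∃ ρ ≠ 0,
      u b = ρ * r * Real.sin (flow 1 B a b α) ∧ p' = ρ * r * Real.cos (flow 1 B a b α)) ∧
    ∀ x ∈ Icc a b, ∃ ρ ≠ 0, u x = ρ * r * Real.sin (flow 1 B a x α) := by
  obtain ⟨v, hv, hvc⟩ := h.exists_linSys hab hc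
  have hva : v a = r * Real.cos α := by
    rw [← hr]
    exact (uniqueDiffWithinAt_Ioi a).eq_deriv _ (hv.hasAEDeriv.hasDerivWithinAt_left hab hvc) hp
  refine ⟨⟨v b, hv.hasAEDeriv.hasDerivWithinAt_right hab hvc, ?_⟩, fun x hx => ?_⟩
  · exact hv.exists_polar_flow hB hab.le hu hva
  · obtain ⟨ρ, h1, h2, -⟩ := (hv.mono le_rfl hx.1 hx.2).exists_polar_flow hB hx.1 hu hva
    exact ⟨ρ, h1, h2⟩

/-- Induction along the list: the angle flows to the next point, the jump kicks it, and the nonzero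
factors multiply up. -/
theorem SolvesOn.exists_eq_sin_angle (hB : BddMeas B) : ∀ {zs : List ℝ} {a p r α : ℝ} {u : ℝ → ℝ},
    Adm ℓ a zs → SolvesOn B ℓ σ zs a u → HasDerivWithinAt u p (Ioi a) a → u a = r * Real.sin α →
    p = r * Real.cos α → (∃ ρ ≠ 0, u ℓ = ρ * r * Real.sin (angle B ℓ σ zs a α)) ∧
      (r = 0 → ∀ x ∈ Icc a ℓ, u x = 0)
  | [], a, p, r, α, u, ha, hu, hp, h1, h2 => by
    have ha' : a < ℓ := ha
    obtain ⟨-, h4⟩ := exists_polar_of_isH2On hB ha'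
      (hu.isH2On a ℓ (by simp)) hu.continuousOn hp h1 h2
    refine ⟨h4 ℓ (right_mem_Icc.2 ha'.le), fun hr x hx => ?_⟩
    obtain ⟨ρ, -, h5⟩ := h4 x hx
    rw [h5, hr]
    simp
  | z :: zs, a, p, r, α, u, ha, hu, hp, h1, h2 => by
    obtain ⟨haz, hz⟩ := ha
    have hzl := hz.lt
    have hsub : Ioo a z ⊆ Ioo a ℓ \ {x | x ∈ z :: zs} := fun x hx =>
      ⟨⟨hx.1, hx.2.trans hzl⟩, fun hxz => by
        rcases List.mem_cons.1 hxz with rfl | hxz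
        · exact lt_irrefl _ hx.2
        · exact lt_asymm hx.2 (hz.lt_of_mem hxz)⟩
    obtain ⟨⟨p', hp', ρ, hρ, h3, h4⟩, h5⟩ := exists_polar_of_isH2On hB haz (hu.isH2On a z hsub)
      (hu.continuousOn.mono (Icc_subset_Icc le_rfl hzl.le)) hp h1 h2
    obtain ⟨p'', s, hp'', hs, hj⟩ := hu.jump z List.mem_cons_self
    have hpp : p'' = p' := (uniqueDiffWithinAt_Iio z).eq_deriv _ hp'' hp'
    obtain ⟨ρ', hρ', h6, h7⟩ := exists_polar_kick σ h3 h4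
    have hs' : s = ρ' * (ρ * r) * Real.cos (kick σ (flow 1 B a z α)) := by
      rw [← h7]
      linarith
    have hu' : SolvesOn B ℓ σ zs z u := by
      refine ⟨hu.continuousOn.mono (Icc_subset_Icc haz.le le_rfl), fun c d hcd => ?_,
        fun y hy => hu.jump y (List.mem_cons_of_mem _ hy)⟩
      refine hu.isH2On c d fun x hx => ?_
      obtain ⟨h8, h9⟩ := hcd hx
      refine ⟨⟨haz.trans h8.1, h8.2⟩, fun hxz => ?_⟩
      rcases List.mem_cons.1 hxz with rfl | hxz
      · exact lt_irrefl _ h8.1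
      · exact h9 hxz
    obtain ⟨⟨ρ'', hρ'', h8⟩, h9⟩ := SolvesOn.exists_eq_sin_angle hB hz hu' hs h6 hs'
    refine ⟨⟨ρ'' * ρ' * ρ, mul_ne_zero (mul_ne_zero hρ'' hρ') hρ, ?_⟩, fun hr x hx => ?_⟩
    · rw [h8, angle]
      ring
    · rcases le_total x z with h | h
      · obtain ⟨ρ, -, h10⟩ := h5 x ⟨hx.1, h⟩
        rw [h10, hr]
        simp
      · exact h9 (by rw [hr]; simp) x ⟨h, hx.2⟩

theorem exists_solvesOn (hB : BddMeas B) : ∀ {zs : List ℝ} {a : ℝ}, Adm ℓ a zs → ∀ x₀ p₀ : ℝ,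
    ∃ u, SolvesOn B ℓ σ zs a u ∧ u a = x₀ ∧ HasDerivWithinAt u p₀ (Ioi a) a
  | [], a, ha, x₀, p₀ => by
    have ha' : a < ℓ := ha
    obtain ⟨u, v, h, rfl, rfl⟩ := exists_linSys hB ha'.le x₀ p₀
    have hvc := h.right.continuousOn ha'.le
    refine ⟨u, ⟨h.left.continuousOn ha'.le, fun c d hcd => ?_, by simp⟩, rfl,
      h.hasAEDeriv.hasDerivWithinAt_left ha' hvc⟩
    exact (h.isH2On hB ha'.le).mono (hcd.trans sdiff_subset)
  | z :: zs, a, ha, x₀, p₀ => by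
    obtain ⟨haz, hz⟩ := ha
    have hzl := hz.lt
    obtain ⟨u₁, v, h, rfl, rfl⟩ := exists_linSys hB haz.le x₀ p₀
    have hvc := h.right.continuousOn haz.le
    -- The initial slope on the right of `z` is the one that the jump condition prescribes.
    obtain ⟨u₂, hu₂, he, hd⟩ := exists_solvesOn hB hz (u₁ z) (v z + σ * u₁ z)
    let u : ℝ → ℝ := fun x => if x ≤ z then u₁ x else u₂ x
    have e1 : EqOn u₁ u (Iic z) := fun x hx => (if_pos hx).symm
    have e2 : EqOn u₂ u (Ici z) := fun x hx => by
      rcases eq_or_lt_of_le (mem_Ici.1 hx) with rfl | h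
      · rw [he]
        exact (if_pos le_rfl).symm
      · exact (if_neg (not_le.2 h)).symm
    refine ⟨u, ⟨?_, fun c d hcd => ?_, fun y hy => ?_⟩, (e1 haz.le).symm, ?_⟩
    · rw [← Icc_union_Icc_eq_Icc haz.le hzl.le]
      exact ((h.left.continuousOn haz.le).congr fun x hx => (e1 hx.2).symm).union_of_isClosed
        (hu₂.continuousOn.congr fun x hx => (e2 hx.1).symm) isClosed_Icc isClosed_Icc
    -- An interval that avoids `z` lies on one side of it.
    · by_cases h1 : z ≤ c
      · have e : EqOn u₂ u (Ioo c d) := fun x hx => e2 (h1.trans hx.1.le)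
        refine (hu₂.isH2On c d fun x hx => ?_).congr e (Eventually.of_forall fun x hx => by
          simp only [e hx])
        exact ⟨⟨h1.trans_lt hx.1, (hcd hx).1.2⟩,
          fun hxz => (hcd hx).2 (List.mem_cons_of_mem _ hxz)⟩
      · by_cases h2 : d ≤ z
        · have e : EqOn u₁ u (Ioo c d) := fun x hx => e1 (hx.2.le.trans h2)
          refine ((h.isH2On hB haz.le).mono fun x hx => ?_).congr e
            (Eventually.of_forall fun x hx => by simp only [e hx])
          exact ⟨(hcd hx).1.1, hx.2.trans_le h2⟩
        · exact absurd List.mem_cons_self (hcd ⟨not_le.1 h1, not_le.1 h2⟩).2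
    · rcases List.mem_cons.1 hy with rfl | hy
      · refine ⟨v y, v y + σ * u₁ y, ?_, ?_, ?_⟩
        · exact (h.hasAEDeriv.hasDerivWithinAt_right haz hvc).congr
            (fun x hx => (e1 (mem_Iic.2 (le_of_lt hx))).symm) (e1 (mem_Iic.2 le_rfl)).symm
        · exact hd.congr (fun x hx => (e2 (mem_Ici.2 (le_of_lt hx))).symm) (e2 (mem_Ici.2 le_rfl)).symm
        · rw [← e1 (mem_Iic.2 le_rfl)]
          ring
      · have hzy := hz.lt_of_mem hy
        obtain ⟨p, r, hp, hr, hj⟩ := hu₂.jump y hy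
        have e : u =ᶠ[𝓝 y] u₂ := by
          filter_upwards [Ioi_mem_nhds hzy] with x hx using (e2 (mem_Ici.2 (le_of_lt hx))).symm
        exact ⟨p, r, hp.congr_of_eventuallyEq (e.filter_mono nhdsWithin_le_nhds) e.eq_of_nhds,
          hr.congr_of_eventuallyEq (e.filter_mono nhdsWithin_le_nhds) e.eq_of_nhds,
          by rw [e.eq_of_nhds, hj]⟩
    · have e : u =ᶠ[𝓝 a] u₁ := by
        filter_upwards [Iio_mem_nhds haz] with x hx using (e1 (mem_Iic.2 (le_of_lt hx))).symm
      exact (h.hasAEDeriv.hasDerivWithinAt_left haz hvc).congr_of_eventuallyEq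
        (e.filter_mono nhdsWithin_le_nhds) e.eq_of_nhds

/-! ### Eigenspaces and the total angle -/

section eigenspace

variable {q q' : ℝ → ℝ} {Z : Finset ℝ} {t : ℝ}

/-- The potential enters only up to null sets, so it may be replaced by a bounded measurable
representative. -/
theorem mem_eigenspace_iff (hqq : ∀ᵐ x, x ∈ Ioo 0 ℓ → q x = q' x) {u : ℝ → ℝ} :
    u ∈ eigenspace ℓ q Z σ t ↔ (∀ x, x ∉ Ioo 0 ℓ → u x = 0) ∧
      SolvesOn (fun x => t - q' x) ℓ σ Z.sort 0 u := by
  have hset : {x | x ∈ Z.sort} = (Z : Set ℝ) := by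
    ext x
    simp
  have hae : ∀ c d, Ioo c d ⊆ Ioo 0 ℓ \ (Z : Set ℝ) → ∀ᵐ x, x ∈ Ioo c d →
      q x * u x - (t • u) x = -((t - q' x) * u x) := fun c d hcd => by
    filter_upwards [hqq] with x hx hx'
    rw [hx (hcd hx').1, Pi.smul_apply, smul_eq_mul]
    ring
  constructor
  · intro h
    have h' : IsImage ℓ q Z σ u (t • u) := h
    refine ⟨h'.eq_zero, h'.continuousOn, fun c d hcd => ?_, fun z hz => h'.jump z (by simpa using hz)⟩
    rw [hset] at hcd
    exact (h'.isH2On c d hcd).congr (fun _ _ => rfl) (hae c d hcd)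
  · rintro ⟨h0, h⟩
    change IsImage ℓ q Z σ u (t • u)
    refine ⟨h0, h.continuousOn, ?_, fun c d hcd => ?_, fun z hz => h.jump z (by simpa using hz)⟩
    · obtain ⟨C, hC⟩ := isCompact_Icc.exists_bound_of_continuousOn h.continuousOn
      refine MemLp.const_smul (MemLp.of_bound (C := C)
        ((h.continuousOn.mono Ioo_subset_Icc_self).aestronglyMeasurable measurableSet_Ioo) ?_) t
      exact (ae_restrict_iff' measurableSet_Ioo).2
        (Eventually.of_forall fun x hx => hC x (Ioo_subset_Icc_self hx))
    · refine (h.isH2On c d (by rwa [hset])).congr (fun _ _ => rfl) ?_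
      filter_upwards [hae c d hcd] with x hx hx' using (hx hx').symm

theorem SolvesOn.exists_hasDerivWithinAt {zs : List ℝ} {a : ℝ} {u : ℝ → ℝ} (ha : Adm ℓ a zs)
    (h : SolvesOn B ℓ σ zs a u) : ∃ p, HasDerivWithinAt u p (Ioi a) a := by
  obtain ⟨b, hab, hbl, hsub⟩ : ∃ b, a < b ∧ b ≤ ℓ ∧ Ioo a b ⊆ Ioo a ℓ \ {x | x ∈ zs} := by
    cases zs with
    | nil => exact ⟨ℓ, ha, le_rfl, by simp⟩
    | cons z zs =>
      refine ⟨z, ha.1, ha.2.lt.le, fun x hx => ⟨⟨hx.1, hx.2.trans ha.2.lt⟩, fun hxz => ?_⟩⟩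
      rcases List.mem_cons.1 hxz with rfl | hxz
      · exact lt_irrefl _ hx.2
      · exact lt_asymm hx.2 (ha.2.lt_of_mem hxz)
  obtain ⟨v, hv, hvc⟩ := (h.isH2On a b hsub).exists_linSys hab
    (h.continuousOn.mono (Icc_subset_Icc le_rfl hbl))
  exact ⟨_, hv.hasAEDeriv.hasDerivWithinAt_left hab hvc⟩

/-- The data at `0` are `(0, p)`, of amplitude `p` and angle `0`: the slope determines `u`, and if
it is nonzero the condition `u ℓ = 0` falls on the angle. -/
theorem exists_of_mem_eigenspace (hℓ : 0 < ℓ) (hZ : (Z : Set ℝ) ⊆ Ioo 0 ℓ) (hq : BddMeas q')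
    (hqq : ∀ᵐ x, x ∈ Ioo 0 ℓ → q x = q' x) {u : ℝ → ℝ} (hu : u ∈ eigenspace ℓ q Z σ t) :
    ∃ p, HasDerivWithinAt u p (Ioi 0) 0 ∧ (p = 0 → u = 0) ∧
      (p ≠ 0 → Real.sin (angle (fun x => t - q' x) ℓ σ Z.sort 0 0) = 0) := by
  obtain ⟨h0, h⟩ := (mem_eigenspace_iff hqq).1 hu
  obtain ⟨p, hp⟩ := h.exists_hasDerivWithinAt (adm_sort hℓ hZ)
  obtain ⟨⟨ρ, hρ, h1⟩, h2⟩ := h.exists_eq_sin_angle (hq.const_sub t) (adm_sort hℓ hZ) hp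
    (r := p) (α := 0) (by simp [h0]) (by simp)
  refine ⟨p, hp, fun hp0 => ?_, fun hp0 => ?_⟩
  · funext x
    by_cases hx : x ∈ Ioo 0 ℓ
    · exact h2 hp0 x (Ioo_subset_Icc_self hx)
    · exact h0 x hx
  · rw [h0 ℓ (by simp)] at h1
    simpa [hρ, hp0] using h1.symm

theorem exists_mem_eigenspace (hℓ : 0 < ℓ) (hZ : (Z : Set ℝ) ⊆ Ioo 0 ℓ) (hq : BddMeas q')
    (hqq : ∀ᵐ x, x ∈ Ioo 0 ℓ → q x = q' x)
    (hs : Real.sin (angle (fun x => t - q' x) ℓ σ Z.sort 0 0) = 0) :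
    ∃ u ∈ eigenspace ℓ q Z σ t, u ≠ 0 := by
  obtain ⟨u, hu, h0, hd⟩ := exists_solvesOn (σ := σ) (hq.const_sub t) (adm_sort hℓ hZ) 0 1
  obtain ⟨⟨ρ, hρ, h1⟩, -⟩ := hu.exists_eq_sin_angle (hq.const_sub t) (adm_sort hℓ hZ) hd
    (r := 1) (α := 0) (by simp [h0]) (by simp)
  rw [hs, mul_zero] at h1
  -- Extension by zero changes nothing on `[0, ℓ]`, as `u` vanishes at both ends; `w ≠ 0` because
  -- its slope at `0` is `1`.
  let w : ℝ → ℝ := (Ioo 0 ℓ).indicator u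
  have e : EqOn u w (Icc 0 ℓ) := fun x hx => by
    by_cases hx' : x ∈ Ioo 0 ℓ
    · exact (indicator_of_mem hx' u).symm
    · simp only [w]
      rw [indicator_of_notMem hx']
      rcases eq_or_lt_of_le hx.1 with h | h
      · rw [← h, h0]
      · rw [(eq_or_lt_of_le hx.2).resolve_right fun h' => hx' ⟨h, h'⟩, h1]
  have e' : ∀ z ∈ Ioo 0 ℓ, w =ᶠ[𝓝 z] u := fun z hz => by
    filter_upwards [isOpen_Ioo.mem_nhds hz] with x hx using (e (Ioo_subset_Icc_self hx)).symm
  refine ⟨w, (mem_eigenspace_iff hqq).2 ⟨fun x hx => indicator_of_notMem hx u, ?_, ?_, ?_⟩, ?_⟩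
  · exact hu.continuousOn.congr e.symm
  · intro c d hcd
    have e2 : EqOn u w (Ioo c d) := fun x hx => e (Ioo_subset_Icc_self (hcd hx).1)
    exact (hu.isH2On c d hcd).congr e2 (Eventually.of_forall fun x hx => by simp only [e2 hx])
  · intro z hz
    obtain ⟨p, r, hp, hr, hj⟩ := hu.jump z hz
    have ez := e' z (hZ (by simpa using hz))
    exact ⟨p, r, hp.congr_of_eventuallyEq (ez.filter_mono nhdsWithin_le_nhds) ez.eq_of_nhds,
      hr.congr_of_eventuallyEq (ez.filter_mono nhdsWithin_le_nhds) ez.eq_of_nhds,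
      by rw [ez.eq_of_nhds, hj]⟩
  · intro hw
    have hd' : HasDerivWithinAt w 1 (Ioi 0) 0 := by
      refine hd.congr_of_eventuallyEq ?_ (e (left_mem_Icc.2 hℓ.le)).symm
      filter_upwards [Ioo_mem_nhdsGT hℓ] with x hx using (e (Ioo_subset_Icc_self hx)).symm
    rw [hw] at hd'
    exact one_ne_zero ((uniqueDiffWithinAt_Ioi (0 : ℝ)).eq_deriv _ hd'
      (hasDerivWithinAt_const (0 : ℝ) (Ioi 0) (0 : ℝ)))

-- The slope at `0` is an injective linear functional on the eigenspace, so every eigenvalue is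
-- simple.
open Classical in
theorem finrank_eigenspace (hℓ : 0 < ℓ) (hZ : (Z : Set ℝ) ⊆ Ioo 0 ℓ) (hq : BddMeas q')
    (hqq : ∀ᵐ x, x ∈ Ioo 0 ℓ → q x = q' x) :
    FiniteDimensional ℝ (eigenspace ℓ q Z σ t) ∧ Module.finrank ℝ (eigenspace ℓ q Z σ t)
      = if Real.sin (angle (fun x => t - q' x) ℓ σ Z.sort 0 0) = 0 then 1 else 0 := by
  split_ifs with hs
  · obtain ⟨v, hv, hv0⟩ := exists_mem_eigenspace hℓ hZ hq hqq hs
    obtain ⟨p, hp, hp0, -⟩ := exists_of_mem_eigenspace hℓ hZ hq hqq hv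
    have h1 : Module.finrank ℝ (eigenspace ℓ q Z σ t) = 1 := by
      refine (finrank_eq_one_iff_of_nonzero' (⟨v, hv⟩ : eigenspace ℓ q Z σ t)
        (fun h => hv0 (congrArg Subtype.val h))).2 fun w => ?_
      obtain ⟨p', hp', -, -⟩ := exists_of_mem_eigenspace hℓ hZ hq hqq w.2
      have hd := (hp.const_smul (p' / p)).sub hp'
      have hm : (p' / p) • v - (w : ℝ → ℝ) ∈ eigenspace ℓ q Z σ t :=
        Submodule.sub_mem _ (Submodule.smul_mem _ _ hv) w.2
      obtain ⟨p'', hp'', hz, -⟩ := exists_of_mem_eigenspace hℓ hZ hq hqq hm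
      have : p'' = (p' / p) • p - p' := (uniqueDiffWithinAt_Ioi (0 : ℝ)).eq_deriv _ hp'' hd
      rw [smul_eq_mul, div_mul_cancel₀ _ (fun h => hv0 (hp0 h)), sub_self] at this
      exact ⟨p' / p, Subtype.ext (sub_eq_zero.1 (hz this))⟩
    exact ⟨Module.finite_of_finrank_eq_succ h1, h1⟩
  · have hbot : eigenspace ℓ q Z σ t = ⊥ := by
      refine (Submodule.eq_bot_iff _).2 fun u hu => ?_
      obtain ⟨p, -, h1, h2⟩ := exists_of_mem_eigenspace hℓ hZ hq hqq hu
      exact h1 (by_contra fun h => hs (h2 h))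
    rw [hbot]
    exact ⟨inferInstance, finrank_bot ℝ _⟩

end eigenspace

/-! ### Dependence of the total angle on the energy and the coupling -/

theorem kick_strictMono (σ : ℝ) : StrictMono (kick σ) := flow_strictMono (.const _) zero_le_one

theorem continuous_kick (σ : ℝ) : Continuous (kick σ) := continuous_flow (.const _) zero_le_one

theorem kick_mono {σ τ α β : ℝ} (h : τ ≤ σ) (hα : α ≤ β) : kick σ α ≤ kick τ β :=
  flow_mono (.const _) (.const _) zero_le_one (fun _ => neg_le_neg h) hα

theorem kick_int_mul_pi (σ : ℝ) (n : ℤ) : kick σ (n * Real.pi) = n * Real.pi :=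
  flow_zero_int_mul_pi (.const _) zero_le_one n

theorem kick_apply_zero (σ : ℝ) : kick σ 0 = 0 := by
  simpa using kick_int_mul_pi σ 0

theorem eventually_kick_le {α ε : ℝ} (hα : α < Real.pi) (hε : 0 < ε) :
    ∀ᶠ σ in atTop, kick σ α ≤ ε := by
  obtain ⟨S, hS⟩ := exists_flow_le (A := 0) le_rfl one_pos hα hε
  filter_upwards [eventually_ge_atTop S] with σ hσ using
    hS _ (.const _) fun _ => neg_le_neg hσ

section angle

variable {ℓ : ℝ}

theorem angle_mono {B B' : ℝ → ℝ} {σ τ : ℝ} (hB : BddMeas B) (hB' : BddMeas B')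
    (h : ∀ x, B x ≤ B' x) (hσ : τ ≤ σ) {zs : List ℝ} {a α β : ℝ} (ha : Adm ℓ a zs) (hα : α ≤ β) :
    angle B ℓ σ zs a α ≤ angle B' ℓ τ zs a β := by
  induction zs generalizing a α β with
  | nil => exact flow_mono hB hB' (le_of_lt ha) h hα
  | cons z zs ih => exact ih ha.2 (kick_mono hσ (flow_mono hB hB' ha.1.le h hα))

variable {q : ℝ → ℝ}

/-- The induction only carries `≤` through the kicks; strictness comes from the last interval. -/
theorem angle_lt_angle (hq : BddMeas q) {s t σ : ℝ} (hst : s < t) {zs : List ℝ} {a α β : ℝ}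
    (ha : Adm ℓ a zs) (hα : α ≤ β) :
    angle (fun x => s - q x) ℓ σ zs a α < angle (fun x => t - q x) ℓ σ zs a β := by
  have key : ∀ {a b α β : ℝ}, a < b → α ≤ β →
      flow 1 (fun x => s - q x) a b α < flow 1 (fun x => t - q x) a b β := fun hab hα =>
    ((flow_strictMono (hq.const_sub s) hab.le).monotone hα).trans_lt
      (flow_lt_flow (hq.const_sub s) hab (sub_pos.2 hst) (hq.const_sub t) fun x => by ring)
  induction zs generalizing a α β with
  | nil => exact key ha hα
  | cons z zs ih => exact ih ha.2 (kick_strictMono σ (key ha.1 hα)).le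

/-- A Lipschitz bound jointly in the energy and the initial angle, which composes along the list.
The bound `T` on the lower energy makes the Gronwall rates uniform. -/
theorem exists_angle_sub_le (hq : BddMeas q) (σ T : ℝ) {zs : List ℝ} {a : ℝ} (ha : Adm ℓ a zs) :
    ∃ C, 0 ≤ C ∧
    ∀ s t α β, |s| ≤ T → s ≤ t → α ≤ β →
      angle (fun x => t - q x) ℓ σ zs a β - angle (fun x => s - q x) ℓ σ zs a α
        ≤ C * (β - α + (t - s)) := by
  obtain ⟨M, hM⟩ := hq.bdd
  have key : ∀ {a b : ℝ}, a < b → ∀ s t α β, |s| ≤ T → s ≤ t → α ≤ β →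
      flow 1 (fun x => t - q x) a b β - flow 1 (fun x => s - q x) a b α
        ≤ Real.exp ((T + M + |1| + 1) * (b - a)) * (β - α + (t - s)) :=
    fun hab s t α β hs hst hα => flow_sub_flow_le (hq.const_sub s)
      (fun x => (abs_sub _ _).trans (add_le_add hs (hM x))) (hq.const_sub t) hab.le
      (sub_nonneg.2 hst) (fun x => by linarith) (fun x => by linarith) hα
  induction zs generalizing a with
  | nil => exact ⟨_, Real.exp_nonneg _, key ha⟩
  | cons z zs ih =>
    obtain ⟨C, hC0, hC⟩ := ih ha.2
    obtain ⟨D, hD0, hD⟩ : ∃ D, 0 ≤ D ∧ ∀ α β, α ≤ β → kick σ β - kick σ α ≤ D * (β - α) :=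
      ⟨_, Real.exp_nonneg _, fun α β h => by
        simpa [kick] using flow_sub_flow_le (A := 0) (a := 0) (b := 1) (.const (-σ)) (fun _ => le_rfl)
          (.const (-σ)) zero_le_one le_rfl (fun _ => le_rfl) (fun _ => by simp) h⟩
    refine ⟨C * (D * Real.exp ((T + M + |1| + 1) * (z - a)) + 1), by positivity,
      fun s t α β hs hst hα => ?_⟩
    have h1 := key ha.1 s t α β hs hst hα
    have h2 := flow_mono (A := 1) (hq.const_sub s) (hq.const_sub t) ha.1.le
      (fun x => by linarith) hα
    have h3 := hC s t _ _ hs hst (kick_mono (σ := σ) le_rfl h2)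
    have h4 := (hD _ _ h2).trans (mul_le_mul_of_nonneg_left h1 hD0)
    refine h3.trans ?_
    rw [mul_assoc]
    refine mul_le_mul_of_nonneg_left ?_ hC0
    linarith

theorem continuous_angle (hq : BddMeas q) (σ : ℝ) {zs : List ℝ} {a : ℝ} (ha : Adm ℓ a zs) (α : ℝ) :
    Continuous fun t => angle (fun x => t - q x) ℓ σ zs a α := by
  refine continuous_iff_continuousAt.2 fun t₀ => ?_
  obtain ⟨C, -, hC⟩ := exists_angle_sub_le hq σ (|t₀| + 1) ha
  refine continuousAt_of_locally_lipschitz one_pos C fun t ht => ?_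
  rw [Real.dist_eq] at ht
  have key : ∀ s t, |s| ≤ |t₀| + 1 → s ≤ t →
      |angle (fun x => t - q x) ℓ σ zs a α - angle (fun x => s - q x) ℓ σ zs a α|
        ≤ C * |t - s| := fun s t hs hst => by
    rw [abs_of_nonneg (sub_nonneg.2 (angle_mono (hq.const_sub s) (hq.const_sub t)
      (fun x => by linarith) le_rfl ha le_rfl)), abs_of_nonneg (sub_nonneg.2 hst)]
    simpa using hC s t α α hs hst le_rfl
  rw [Real.dist_eq, Real.dist_eq]
  rcases le_total t t₀ with h | h
  · rw [abs_sub_comm, abs_sub_comm t]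
    refine key t t₀ ?_ h
    have := abs_add_le (t - t₀) t₀
    rw [sub_add_cancel] at this
    linarith
  · exact key t₀ t (by linarith) h

theorem angle_pos (hq : BddMeas q) {t σ : ℝ} {zs : List ℝ} {a α : ℝ} (ha : Adm ℓ a zs) (hα : 0 ≤ α) :
    0 < angle (fun x => t - q x) ℓ σ zs a α := by
  have key : ∀ {a b α : ℝ}, a < b → 0 ≤ α → 0 < flow 1 (fun x => t - q x) a b α := fun hab hα => by
    simpa using int_mul_pi_lt_flow (hq.const_sub t) hab (n := 0) (by simpa using hα)
  induction zs generalizing a α with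
  | nil => exact key ha hα
  | cons z zs ih =>
    refine ih ha.2 ?_
    rw [← kick_apply_zero σ]
    exact (kick_strictMono σ).monotone (key ha.1 hα).le

/-- Kicks fix `0` and are increasing, so the angle enters the last interval nonnegative for every
`σ`, and that interval alone produces the growth. Hence `T` does not depend on `σ`, which keeps the
limits of the eigenvalues finite. -/
theorem exists_le_angle (hq : BddMeas q) (N : ℝ) : ∀ {zs : List ℝ} {a : ℝ}, Adm ℓ a zs →
    ∃ T, ∀ t σ α, T ≤ t → 0 ≤ α → N ≤ angle (fun x => t - q x) ℓ σ zs a α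
  | [], a, ha => by
    obtain ⟨M, hM⟩ := hq.bdd
    obtain ⟨T, hT⟩ := exists_le_flow ha N
    refine ⟨T + M, fun t σ α ht hα => (hT _ (hq.const_sub t) fun x => ?_).trans
      ((flow_strictMono (hq.const_sub t) (le_of_lt ha)).monotone hα)⟩
    have := (abs_le.1 (hM x)).2
    linarith
  | z :: zs, a, ha => by
    obtain ⟨T, hT⟩ := exists_le_angle hq N ha.2
    refine ⟨T, fun t σ α ht hα => hT t σ _ ht ?_⟩
    have h := int_mul_pi_lt_flow (hq.const_sub t) ha.1 (n := 0) (by simpa using hα)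
    rw [← kick_apply_zero σ]
    exact (kick_strictMono σ).monotone (by simpa using h.le)

/-- Very negative energy pushes the angle below a `δ` whose kick is still below `π`, and the next
interval starts under the same hypothesis. -/
theorem eventually_angle_le (hq : BddMeas q) (σ : ℝ) {zs : List ℝ} {a α ε : ℝ} (ha : Adm ℓ a zs)
    (hα : α < Real.pi) (hε : 0 < ε) : ∀ᶠ t in atBot, angle (fun x => t - q x) ℓ σ zs a α ≤ ε := by
  obtain ⟨M, hM⟩ := hq.bdd
  have key : ∀ {a b α ε : ℝ}, a < b → α < Real.pi → 0 < ε →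
      ∀ᶠ t in atBot, flow 1 (fun x => t - q x) a b α ≤ ε := fun hab hα hε => by
    obtain ⟨S, hS⟩ := exists_flow_le zero_le_one hab hα hε
    filter_upwards [eventually_le_atBot (-S - M)] with t ht
    refine hS _ (hq.const_sub t) fun x => ?_
    have := (abs_le.1 (hM x)).1
    linarith
  induction zs generalizing a α with
  | nil => exact key ha hα hε
  | cons z zs ih =>
    obtain ⟨δ, hδ0, hδ⟩ : ∃ δ > 0, kick σ δ < Real.pi := by
      have h1 : ∀ᶠ δ in 𝓝 (0 : ℝ), kick σ δ < Real.pi :=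
        (continuous_kick σ).continuousAt.eventually
          (gt_mem_nhds (by rw [kick_apply_zero]; exact Real.pi_pos))
      obtain ⟨δ, h2, h3⟩ := ((h1.filter_mono nhdsWithin_le_nhds).and
        (self_mem_nhdsWithin (s := Ioi (0 : ℝ)))).exists
      exact ⟨δ, h3, h2⟩
    filter_upwards [key ha.1 hα hδ0, ih ha.2 hδ] with t h1 h2
    exact (angle_mono (hq.const_sub t) (hq.const_sub t) (fun _ => le_rfl) le_rfl ha.2
      ((kick_strictMono σ).monotone h1)).trans h2

/-- The parameters with a given positive angle exist. -/
theorem exists_angle_eq (hq : BddMeas q) (σ : ℝ) {zs : List ℝ} {a : ℝ} (ha : Adm ℓ a zs) {N : ℝ}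
    (hN : 0 < N) :
    ∃ t, angle (fun x => t - q x) ℓ σ zs a 0 = N := by
  obtain ⟨s, hs⟩ := (eventually_angle_le hq σ ha Real.pi_pos hN).exists
  obtain ⟨t, ht⟩ := exists_le_angle hq N ha
  exact mem_range_of_exists_le_of_exists_ge (continuous_angle hq σ ha 0) ⟨s, hs⟩
    ⟨t, ht t σ 0 le_rfl le_rfl⟩

end angle

/-! ### Strong coupling -/

section limit

variable {B : ℝ → ℝ} {ℓ : ℝ}

/-- On each of the intervals, the angle stays below `π`. -/
def Gap (B : ℝ → ℝ) (ℓ : ℝ) : List ℝ → ℝ → ℝ → Prop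
  | [], a, α => flow 1 B a ℓ α < Real.pi
  | z :: zs, a, α => flow 1 B a z α < Real.pi ∧ Gap B ℓ zs z 0

/-- Only the first interval sees the initial angle, and there the condition is open. -/
theorem Gap.exists_pos (hB : BddMeas B) {zs : List ℝ} {a : ℝ} (ha : Adm ℓ a zs)
    (h : Gap B ℓ zs a 0) : ∃ ε > 0, Gap B ℓ zs a ε := by
  have key : ∀ b, a < b → flow 1 B a b 0 < Real.pi → ∃ ε > 0, flow 1 B a b ε < Real.pi :=
    fun b hab hb => by
    have h1 : ∀ᶠ ε in 𝓝 (0 : ℝ), flow 1 B a b ε < Real.pi :=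
      (continuous_flow hB hab.le).continuousAt.eventually (gt_mem_nhds hb)
    obtain ⟨ε, h2, h3⟩ := ((h1.filter_mono nhdsWithin_le_nhds).and
      (self_mem_nhdsWithin (s := Ioi (0 : ℝ)))).exists
    exact ⟨ε, h3, h2⟩
  cases zs with
  | nil => exact key ℓ ha h
  | cons z zs =>
    obtain ⟨ε, hε, h1⟩ := key z ha.1 h.1
    exact ⟨ε, hε, h1, h.2⟩

/-- A strong kick brings an angle below `π` down to at most `ε`, so each interval starts low enough
for the gap to persist to its end. -/
theorem Gap.eventually_angle_lt (hB : BddMeas B) : ∀ {zs : List ℝ} {a α : ℝ}, Adm ℓ a zs →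
    Gap B ℓ zs a α → ∀ᶠ σ in atTop, angle B ℓ σ zs a α < Real.pi
  | [], _, _, _, h => Eventually.of_forall fun _ => h
  | z :: zs, a, α, ha, h => by
    obtain ⟨ε, hε, h1⟩ := h.2.exists_pos hB ha.2
    filter_upwards [eventually_kick_le h.1 hε, h1.eventually_angle_lt hB ha.2] with σ h2 h3
    exact (angle_mono hB hB (fun _ => le_rfl) le_rfl ha.2 h2).trans_lt h3

end limit

/-! ### Ordered eigenvalues as level points of the total angle -/

section ordered

variable {ℓ : ℝ} {q q' : ℝ → ℝ} {Z : Finset ℝ} {σ : ℝ}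

/-- At an eigenvalue the angle is `m π` with `m ≥ 1` by `angle_pos`, and injectivity of the angle in
the energy identifies the eigenvalue with the `m`-th listed one. -/
theorem isOrderedEigenvalues_of_angle (hℓ : 0 < ℓ) (hZ : (Z : Set ℝ) ⊆ Ioo 0 ℓ) (hq : BddMeas q')
    (hqq : ∀ᵐ x, x ∈ Ioo 0 ℓ → q x = q' x) {lam : ℕ+ → ℝ}
    (h : ∀ n : ℕ+, angle (fun x => lam n - q' x) ℓ σ Z.sort 0 0 = n * Real.pi) :
    IsOrderedEigenvalues (eigenspace ℓ q Z σ) lam := by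
  have hm : StrictMono fun t => angle (fun x => t - q' x) ℓ σ Z.sort 0 0 :=
    fun s t hst => angle_lt_angle hq hst (adm_sort hℓ hZ) le_rfl
  refine ⟨fun m n hmn => ?_, fun t => (finrank_eigenspace hℓ hZ hq hqq).1, fun t => ?_⟩
  · refine hm.le_iff_le.1 ?_
    simp only [h]
    have : (m : ℝ) ≤ n := by exact_mod_cast hmn
    exact mul_le_mul_of_nonneg_right this Real.pi_pos.le
  · have hinj : ∀ m n : ℕ+, (m : ℝ) * Real.pi = n * Real.pi → m = n := fun m n hmn => by
      have := mul_right_cancel₀ Real.pi_ne_zero hmn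
      exact_mod_cast this
    rw [(finrank_eigenspace hℓ hZ hq hqq).2]
    split_ifs with hs
    · obtain ⟨k, hk⟩ := Real.sin_eq_zero_iff.1 hs
      have hk0 : 0 < k := by
        have := angle_pos hq (t := t) (σ := σ) (adm_sort hℓ hZ) le_rfl
        rw [← hk] at this
        exact_mod_cast pos_of_mul_pos_left this Real.pi_pos.le
      obtain ⟨m, hmk⟩ : ∃ m : ℕ+, (m : ℝ) = k := by
        lift k to ℕ using hk0.le
        exact ⟨⟨k, by exact_mod_cast hk0⟩, by simp⟩
      have hset : {n | lam n = t} = {m} := by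
        ext n
        simp only [mem_ofPred_eq, mem_singleton_iff]
        constructor
        · rintro rfl
          exact hinj _ _ (by rw [hmk, hk, h])
        · rintro rfl
          refine hm.injective ?_
          simp only [h]
          rw [hmk, hk]
      rw [hset]
      simp
    · have hset : {n | lam n = t} = ∅ := by
        refine eq_empty_of_forall_notMem fun n hn => hs ?_
        rw [← (hn : lam n = t), h]
        exact Real.sin_nat_mul_pi n
      rw [hset]
      simp

theorem exists_isOrderedEigenvalues (hℓ : 0 < ℓ) (hZ : (Z : Set ℝ) ⊆ Ioo 0 ℓ) (hq : BddMeas q')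
    (hqq : ∀ᵐ x, x ∈ Ioo 0 ℓ → q x = q' x) :
    ∃ lam : ℕ+ → ℝ, IsOrderedEigenvalues (eigenspace ℓ q Z σ) lam := by
  choose lam h using fun n : ℕ+ => exists_angle_eq hq σ (adm_sort hℓ hZ)
    (N := n * Real.pi) (mul_pos (by exact_mod_cast n.pos) Real.pi_pos)
  exact ⟨lam, isOrderedEigenvalues_of_angle hℓ hZ hq hqq h⟩

theorem IsOrderedEigenvalues.strictMono_and_range {E : ℝ → Submodule ℝ (ℝ → ℝ)} {lam : ℕ+ → ℝ}
    (h : IsOrderedEigenvalues E lam) (hE : ∀ t, Module.finrank ℝ (E t) ≤ 1) :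
    StrictMono lam ∧ range lam = {t | Module.finrank ℝ (E t) ≠ 0} := by
  refine ⟨h.monotone.strictMono_of_injective fun m n hmn => ?_, ?_⟩
  · have h1 : {i | lam i = lam n}.encard ≤ 1 := by
      rw [h.encard_eq]
      exact_mod_cast hE _
    exact encard_le_one_iff.1 h1 m n hmn rfl
  · ext t
    have h1 := h.encard_eq t
    constructor
    · rintro ⟨n, rfl⟩ h0
      rw [h0, Nat.cast_zero, encard_eq_zero] at h1
      exact eq_empty_iff_forall_notMem.1 h1 n rfl
    · intro h0
      have : {n | lam n = t}.encard ≠ 0 := by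
        rw [h1]
        exact_mod_cast h0
      exact nonempty_iff_ne_empty.2 (encard_ne_zero.1 this).ne_empty

/-- A strictly increasing sequence is determined by its range, so any ordered list of eigenvalues is
the one constructed from the angle. -/
theorem IsOrderedEigenvalues.strictMono_and_angle_eq (hℓ : 0 < ℓ) (hZ : (Z : Set ℝ) ⊆ Ioo 0 ℓ)
    (hq : BddMeas q') (hqq : ∀ᵐ x, x ∈ Ioo 0 ℓ → q x = q' x) {lam : ℕ+ → ℝ}
    (h : IsOrderedEigenvalues (eigenspace ℓ q Z σ) lam) : StrictMono lam ∧
      ∀ n : ℕ+, angle (fun x => lam n - q' x) ℓ σ Z.sort 0 0 = n * Real.pi := by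
  choose lam' h' using fun n : ℕ+ => exists_angle_eq hq σ (adm_sort hℓ hZ)
    (N := n * Real.pi) (mul_pos (by exact_mod_cast n.pos) Real.pi_pos)
  have hE : ∀ t, Module.finrank ℝ (eigenspace ℓ q Z σ t) ≤ 1 := fun t => by
    rw [(finrank_eigenspace hℓ hZ hq hqq).2]
    split_ifs <;> simp
  obtain ⟨h1, h2⟩ := h.strictMono_and_range hE
  obtain ⟨h3, h4⟩ := (isOrderedEigenvalues_of_angle hℓ hZ hq hqq h').strictMono_and_range hE
  have : lam = lam' := (h1.range_inj h3).1 (h2.trans h4.symm)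
  rw [this]
  exact ⟨h3, h'⟩

end ordered

/-! ### Zeros and nodal domains -/

theorem sin_ne_zero_iff_floor (y : ℝ) :
    Real.sin y ≠ 0 ↔ ⌊y / Real.pi⌋ * Real.pi < y ∧ y < (⌊y / Real.pi⌋ + 1) * Real.pi := by
  have hpi := Real.pi_pos
  have h1 : ⌊y / Real.pi⌋ * Real.pi ≤ y := (le_div_iff₀ hpi).1 (Int.floor_le _)
  have h2 : y < (⌊y / Real.pi⌋ + 1) * Real.pi := (div_lt_iff₀ hpi).1 (Int.lt_floor_add_one _)
  constructor
  · refine fun h => ⟨lt_of_le_of_ne h1 fun h3 => h ?_, h2⟩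
    rw [← h3]
    exact Real.sin_int_mul_pi _
  · rintro ⟨h3, -⟩ h4
    have h5 := Real.sin_pos_of_pos_of_lt_pi (x := y - ⌊y / Real.pi⌋ * Real.pi) (by linarith)
      (by linarith)
    rw [Real.sin_sub_int_mul_pi, h4] at h5
    simp at h5

theorem floor_div_pi_eq_iff {y : ℝ} {n : ℤ} (hy : Real.sin y ≠ 0) :
    ⌊y / Real.pi⌋ = n ↔ n * Real.pi < y ∧ y < (n + 1) * Real.pi := by
  constructor
  · rintro rfl
    exact (sin_ne_zero_iff_floor y).1 hy
  · rintro ⟨h1, h2⟩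
    rw [Int.floor_eq_iff, le_div_iff₀ Real.pi_pos, div_lt_iff₀ Real.pi_pos]
    exact ⟨h1.le, h2⟩

theorem sin_ne_zero_of_lt_of_lt {y : ℝ} {n : ℤ} (h1 : n * Real.pi < y)
    (h2 : y < (n + 1) * Real.pi) : Real.sin y ≠ 0 := by
  intro h4
  have h5 := Real.sin_pos_of_pos_of_lt_pi (x := y - n * Real.pi) (by linarith) (by linarith)
  rw [Real.sin_sub_int_mul_pi, h4] at h5
  simp at h5

section angle

variable {B θ φ : ℝ → ℝ} {ℓ : ℝ}

theorem IsAngle.int_mul_pi_lt_of_le (hB : BddMeas B) (hθ : IsAngle 1 B 0 ℓ θ) {x y : ℝ}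
    (hx : 0 ≤ x) (hxy : x < y) (hy : y ≤ ℓ) {n : ℤ} (hn : n * Real.pi ≤ θ x) :
    n * Real.pi < θ y :=
  (hθ.mono hx hxy.le hy).int_mul_pi_lt hB hxy hn

/-- No multiple of `π` is reached twice, so `θ` maps the zeros injectively into the finitely many
multiples between `0` and `k π`. -/
theorem finite_zeros (hB : BddMeas B) (hθ : IsAngle 1 B 0 ℓ θ) (h0 : θ 0 = 0) {k : ℕ}
    (hk : θ ℓ = k * Real.pi) : {x | x ∈ Ioo 0 ℓ ∧ Real.sin (θ x) = 0}.Finite := by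
  refine Finite.of_finite_image (f := θ) ?_ ?_
  · refine ((Set.finite_Icc (0 : ℤ) (k : ℤ)).image fun i : ℤ => (i : ℝ) * Real.pi).subset ?_
    rintro _ ⟨x, ⟨hx, hs⟩, rfl⟩
    obtain ⟨n, hn⟩ := Real.sin_eq_zero_iff.1 hs
    refine ⟨n, ⟨?_, ?_⟩, hn⟩
    · have := hθ.int_mul_pi_lt_of_le hB le_rfl hx.1 hx.2.le (n := 0) (by simp [h0])
      rw [← hn] at this
      simp only [Int.cast_zero, zero_mul] at this
      exact_mod_cast (pos_of_mul_pos_left this Real.pi_pos.le).le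
    · have := hθ.int_mul_pi_lt_of_le hB hx.1.le hx.2 le_rfl hn.le
      rw [hk] at this
      exact_mod_cast (lt_of_mul_lt_mul_right this Real.pi_pos.le).le
  · have key : ∀ x y, x ∈ Ioo 0 ℓ → y ∈ Ioo 0 ℓ → Real.sin (θ x) = 0 → θ x = θ y → ¬ x < y := by
      intro x y hx hy hs he hxy
      obtain ⟨n, hn⟩ := Real.sin_eq_zero_iff.1 hs
      have := hθ.int_mul_pi_lt_of_le hB hx.1.le hxy hy.2.le hn.le
      rw [hn, he] at this
      exact lt_irrefl _ this
    rintro x ⟨hx, hsx⟩ y ⟨hy, hsy⟩ he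
    exact le_antisymm (not_lt.1 (key y x hy hx hsy he.symm)) (not_lt.1 (key x y hx hy hsx he))

/-- `⌊θ / π⌋` is continuous off the zeros, hence constant on components. It separates them because
upward crossing prevents `θ` from leaving a strip and returning. -/
theorem nodalCount_eq (hB : BddMeas B) (hθ : IsAngle 1 B 0 ℓ θ) (hℓ : 0 < ℓ) (h0 : θ 0 = 0)
    {k : ℕ} (hk : θ ℓ = k * Real.pi)
    (hφ : ∀ x ∈ Icc 0 ℓ, φ x = 0 ↔ Real.sin (θ x) = 0) : nodalCount ℓ φ = k := by
  have hc := hθ.continuousOn hℓ.le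
  let X := {x : ℝ // x ∈ Ioo 0 ℓ ∧ φ x ≠ 0}
  let f : X → ℤ := fun x => ⌊θ x / Real.pi⌋
  have hs : ∀ x : X, Real.sin (θ x) ≠ 0 := fun x h =>
    x.2.2 ((hφ x (Ioo_subset_Icc_self x.2.1)).2 h)
  have hθX : Continuous fun x : X => θ x :=
    hc.comp_continuous continuous_subtype_val fun x => Ioo_subset_Icc_self x.2.1
  have hind : Topology.IsInducing fun x : X => (x : ℝ) := ⟨rfl⟩
  have hf : Continuous f := by
    refine continuous_discrete_rng.2 fun n => ?_
    have : f ⁻¹' {n} = (fun x : X => θ x) ⁻¹' Ioo (n * Real.pi) ((n + 1) * Real.pi) := by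
      ext x
      exact floor_div_pi_eq_iff (hs x)
    rw [this]
    exact isOpen_Ioo.preimage hθX
  have hconn : ∀ x y : X, (x : ℝ) ≤ y → f x = f y →
      connectedComponent x = connectedComponent y := by
    intro x y hxy he
    have hx := (floor_div_pi_eq_iff (hs x)).1 (rfl : f x = f x)
    have hy := (floor_div_pi_eq_iff (hs y)).1 he.symm
    have hsub : Icc (x : ℝ) y ⊆ range fun x : X => (x : ℝ) := fun z hz => by
      have hz0 : z ∈ Ioo 0 ℓ := ⟨x.2.1.1.trans_le hz.1, hz.2.trans_lt y.2.1.2⟩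
      refine ⟨⟨z, hz0, fun hφz => ?_⟩, rfl⟩
      have h1 : f x * Real.pi < θ z := by
        rcases eq_or_lt_of_le hz.1 with h | h
        · rw [← h]
          exact hx.1
        · exact hθ.int_mul_pi_lt_of_le hB x.2.1.1.le h hz0.2.le hx.1.le
      have h2 : θ z < (f x + 1) * Real.pi := by
        rcases eq_or_lt_of_le hz.2 with h | h
        · rw [h]
          exact hy.2
        · by_contra h3
          have := hθ.int_mul_pi_lt_of_le hB hz0.1.le h y.2.1.2.le (n := f x + 1)
            (by push_cast; exact not_lt.1 h3)
          push_cast at this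
          exact lt_asymm this hy.2
      exact sin_ne_zero_of_lt_of_lt h1 h2 ((hφ z (Ioo_subset_Icc_self hz0)).1 hφz)
    have hpre : IsPreconnected ((fun x : X => (x : ℝ)) ⁻¹' Icc (x : ℝ) y) := by
      refine hind.isPreconnected_image.1 ?_
      rw [image_preimage_eq_of_subset hsub]
      exact isPreconnected_Icc
    refine connectedComponent_eq ?_
    exact hpre.subset_connectedComponent (left_mem_Icc.2 hxy) (right_mem_Icc.2 hxy)
  let F : ConnectedComponents X → ℤ := hf.connectedComponentsLift
  have hF : ∀ x : X, F x = f x := fun x => hf.connectedComponentsLift_apply_coe x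
  have hinj : Function.Injective F := by
    intro a b hab
    obtain ⟨x, rfl⟩ := ConnectedComponents.surjective_coe a
    obtain ⟨y, rfl⟩ := ConnectedComponents.surjective_coe b
    rw [hF, hF] at hab
    rw [ConnectedComponents.coe_eq_coe]
    rcases le_total (x : ℝ) y with h | h
    · exact hconn x y h hab
    · exact (hconn y x h hab.symm).symm
  have hrange : range F = ((Finset.Ico (0 : ℤ) k : Finset ℤ) : Set ℤ) := by
    ext n
    rw [Finset.coe_Ico]
    constructor
    · rintro ⟨a, rfl⟩
      obtain ⟨x, rfl⟩ := ConnectedComponents.surjective_coe a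
      rw [hF]
      have hx := (floor_div_pi_eq_iff (hs x)).1 (rfl : f x = f x)
      have h1 := hθ.int_mul_pi_lt_of_le hB le_rfl x.2.1.1 x.2.1.2.le (n := 0) (by simp [h0])
      have h2 := hθ.int_mul_pi_lt_of_le hB x.2.1.1.le x.2.1.2 le_rfl hx.1.le
      rw [hk] at h2
      have h3 : (0 : ℝ) < f x + 1 := by
        simp only [Int.cast_zero, zero_mul] at h1
        exact pos_of_mul_pos_left (h1.trans hx.2) Real.pi_pos.le
      have h4 : (0 : ℤ) < f x + 1 := by exact_mod_cast h3
      refine ⟨by omega, ?_⟩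
      exact_mod_cast lt_of_mul_lt_mul_right h2 Real.pi_pos.le
    · rintro ⟨h1, h2⟩
      have h3 : (0 : ℝ) ≤ n := by exact_mod_cast h1
      have h4 : (n : ℝ) + 1 ≤ k := by exact_mod_cast h2
      have hpi := Real.pi_pos
      -- The label `n` is attained where `θ` passes the middle of its strip.
      have hmem : ((n : ℝ) + 1 / 2) * Real.pi ∈ Ioo (θ 0) (θ ℓ) := by
        rw [h0, hk]
        constructor <;> nlinarith
      obtain ⟨x, hx, hxe⟩ := intermediate_value_Ioo hℓ.le hc hmem
      have hn1 : n * Real.pi < θ x := by rw [hxe]; nlinarith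
      have hn2 : θ x < (n + 1) * Real.pi := by rw [hxe]; nlinarith
      have hsx := sin_ne_zero_of_lt_of_lt hn1 hn2
      refine ⟨((⟨x, hx, fun h => hsx ((hφ x (Ioo_subset_Icc_self hx)).1 h)⟩ : X) :
        ConnectedComponents X), ?_⟩
      rw [hF]
      exact (floor_div_pi_eq_iff hsx).2 ⟨hn1, hn2⟩
  change ENat.card (ConnectedComponents X) = k
  rw [← encard_univ, ← hinj.encard_image, image_univ, hrange, encard_coe_eq_coe_finsetCard]
  simp

/-- All kicks occur at multiples of `π`, where they act trivially, so the total angle is the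
unkicked one for every `σ`. -/
theorem angle_eq_of_sin_eq_zero (hB : BddMeas B) (hθ : IsAngle 1 B 0 ℓ θ) (σ : ℝ) {zs : List ℝ}
    {a : ℝ} (ha : Adm ℓ a zs) (ha0 : 0 ≤ a) (h : ∀ z ∈ zs, Real.sin (θ z) = 0) :
    angle B ℓ σ zs a (θ a) = θ ℓ := by
  induction zs generalizing a with
  | nil => exact (hθ.mono ha0 (le_of_lt ha) le_rfl).flow_eq hB (le_of_lt ha)
  | cons z zs ih =>
    obtain ⟨n, hn⟩ := Real.sin_eq_zero_iff.1 (h z List.mem_cons_self)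
    rw [angle, (hθ.mono ha0 ha.1.le ha.2.lt.le).flow_eq hB ha.1.le, ← hn, kick_int_mul_pi, hn]
    exact ih ha.2 (ha0.trans ha.1.le) fun y hy => h y (List.mem_cons_of_mem _ hy)

/-- Between consecutive zeros `θ` climbs by at most `π`, or else it would pass a further zero.
Lowering the energy makes the climb strictly smaller. -/
theorem gap_of_lt {q : ℝ → ℝ} (hq : BddMeas q) {s t : ℝ} (hst : s < t)
    (hθ : IsAngle 1 (fun x => t - q x) 0 ℓ θ) {zs : List ℝ} {a : ℝ} (ha : Adm ℓ a zs)
    (ha0 : 0 ≤ a) (hsa : Real.sin (θ a) = 0)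
    (h : ∀ x ∈ Ioo a ℓ, Real.sin (θ x) = 0 ↔ x ∈ zs) : Gap (fun x => s - q x) ℓ zs a 0 := by
  have key : ∀ {a b : ℝ}, 0 ≤ a → a < b → b ≤ ℓ → Real.sin (θ a) = 0 →
      (∀ x ∈ Ioo a b, Real.sin (θ x) ≠ 0) → flow 1 (fun x => s - q x) a b 0 < Real.pi := by
    intro a b ha0 hab hb hsa hne
    refine (flow_lt_flow (hq.const_sub s) hab (sub_pos.2 hst) (hq.const_sub t)
      fun x => by ring).trans_le ?_
    obtain ⟨n, hn⟩ := Real.sin_eq_zero_iff.1 hsa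
    have hθab := hθ.mono ha0 hab.le hb
    -- Periodicity shifts the start `θ a = n π` to `0`.
    have h1 := flow_add_int_mul_pi (A := 1) (hq.const_sub t) hab.le 0 n
    rw [zero_add, hn, hθab.flow_eq (hq.const_sub t) hab.le] at h1
    by_contra! h2
    obtain ⟨x, hx, hxe⟩ := intermediate_value_Ioo hab.le (hθab.continuousOn hab.le)
      (show θ a + Real.pi ∈ Ioo (θ a) (θ b) from ⟨by linarith [Real.pi_pos], by linarith⟩)
    refine hne x hx ?_
    rw [hxe, Real.sin_add_pi, hsa, neg_zero]
  induction zs generalizing a with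
  | nil => exact key ha0 ha le_rfl hsa fun x hx h0 => by simpa using (h x hx).1 h0
  | cons z zs ih =>
    have hz : z ∈ Ioo a ℓ := ⟨ha.1, ha.2.lt⟩
    refine ⟨key ha0 ha.1 ha.2.lt.le hsa fun x hx h0 => ?_,
      ih ha.2 (ha0.trans ha.1.le) ((h z hz).2 List.mem_cons_self) fun x hx => ?_⟩
    · rcases List.mem_cons.1 ((h x ⟨hx.1, hx.2.trans hz.2⟩).1 h0) with rfl | hxz
      · exact lt_irrefl _ hx.2
      · exact lt_asymm hx.2 (ha.2.lt_of_mem hxz)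
    · rw [h x ⟨ha.1.trans hx.1, hx.2⟩, List.mem_cons, or_iff_right hx.1.ne']

end angle

/-! ### The Dirichlet eigenfunction, the bounded potential and the conclusion -/

theorem exists_angle_of_mem_dirichletEigenspace {ℓ : ℝ} {q q' φ : ℝ → ℝ} {t : ℝ} (hℓ : 0 < ℓ)
    (hq : BddMeas q') (hqq : ∀ᵐ x, x ∈ Ioo 0 ℓ → q x = q' x)
    (hφ : φ ∈ dirichletEigenspace ℓ q t) (h0 : φ ≠ 0) :
    ∃ θ, θ 0 = 0 ∧ IsAngle 1 (fun x => t - q' x) 0 ℓ θ ∧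
      ∀ x ∈ Icc 0 ℓ, φ x = 0 ↔ Real.sin (θ x) = 0 := by
  obtain ⟨θ, hθ0, hθ⟩ := exists_isAngle 1 (hq.const_sub t) hℓ.le 0
  refine ⟨θ, hθ0, hθ, ?_⟩
  obtain ⟨p, hp, hp0, -⟩ := exists_of_mem_eigenspace hℓ (by simp) hq hqq hφ
  obtain ⟨h1, h2⟩ := (mem_eigenspace_iff hqq).1 hφ
  have hne : p ≠ 0 := fun h => h0 (hp0 h)
  have h3 := (exists_polar_of_isH2On (r := p) (α := 0) (hq.const_sub t) hℓ
    (h2.isH2On 0 ℓ (by simp)) h2.continuousOn hp (by simp [h1]) (by simp)).2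
  intro x hx
  obtain ⟨ρ, hρ, h4⟩ := h3 x hx
  have h5 := (hθ.mono le_rfl hx.1 hx.2).flow_eq (hq.const_sub t) hx.1
  rw [hθ0] at h5
  rw [h4, h5]
  simp [hρ, hne]

/-- A measurable representative is truncated at the essential supremum of `|q|`. -/
theorem exists_bddMeas_ae_eq {ℓ : ℝ} {q : ℝ → ℝ} (hq : MemLp q ⊤ (volume.restrict (Ioo 0 ℓ))) :
    ∃ q', BddMeas q' ∧ ∀ᵐ x, x ∈ Ioo 0 ℓ → q x = q' x := by
  obtain ⟨q₀, hq₀, he⟩ := hq.1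
  have hb : ∀ᵐ x ∂(volume.restrict (Ioo 0 ℓ)),
      ‖q x‖ ≤ (eLpNorm q ⊤ (volume.restrict (Ioo 0 ℓ))).toReal := by
    filter_upwards [ae_le_eLpNormEssSup (f := q) (μ := volume.restrict (Ioo 0 ℓ))] with x hx
    rw [← toReal_enorm, eLpNorm_exponent_top]
    refine ENNReal.toReal_mono ?_ hx
    rw [← eLpNorm_exponent_top]
    exact hq.2.ne
  set C := (eLpNorm q ⊤ (volume.restrict (Ioo 0 ℓ))).toReal
  have hC : 0 ≤ C := ENNReal.toReal_nonneg
  refine ⟨fun x => max (-C) (min C (q₀ x)), ⟨?_, C, fun x => ?_⟩, ?_⟩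
  · exact measurable_const.max (measurable_const.min hq₀.measurable)
  · exact abs_le.2 ⟨le_max_left _ _, max_le (by linarith) (min_le_left _ _)⟩
  · refine (ae_restrict_iff' measurableSet_Ioo).1 ?_
    filter_upwards [he, hb] with x h1 h2
    obtain ⟨h3, h4⟩ := abs_le.1 h2
    rw [← h1, min_eq_right h4, max_eq_right h3]

end DeltaFlow

theorem mainTheorem6 (ℓ : ℝ) (hℓ : 0 < ℓ) (q : ℝ → ℝ)
    (hq : MemLp q ⊤ (volume.restrict (Ioo 0 ℓ))) :
    -- the ordered eigenvalues exist
    (∀ Z : Finset ℝ, (Z : Set ℝ) ⊆ Ioo 0 ℓ → ∀ σ : ℝ,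
      ∃ lam : ℕ+ → ℝ, DeltaFlow.IsOrderedEigenvalues (DeltaFlow.eigenspace ℓ q Z σ) lam) ∧
    -- a Dirichlet eigenfunction `φ` for the `k`-th Dirichlet eigenvalue `dir k`
    ∀ dir : ℕ+ → ℝ, DeltaFlow.IsOrderedEigenvalues (DeltaFlow.dirichletEigenspace ℓ q) dir →
    ∀ (k : ℕ+) (φ : ℝ → ℝ), φ ∈ DeltaFlow.dirichletEigenspace ℓ q (dir k) → φ ≠ 0 →
    ∃ Z : Finset ℝ, (Z : Set ℝ) = DeltaFlow.nodalSet ℓ φ ∧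
      (∀ lam : ℝ → ℕ+ → ℝ,
        (∀ σ : ℝ, DeltaFlow.IsOrderedEigenvalues (DeltaFlow.eigenspace ℓ q Z σ) (lam σ)) →
        -- the eigenvalues are simple and nondecreasing in `σ`, and the `k`-th one is constant
        (∀ σ : ℝ, StrictMono (lam σ)) ∧
        (∀ n : ℕ+, Monotone fun σ => lam σ n) ∧
        (∀ σ : ℝ, lam σ k = dir k) ∧
        -- the limits as `σ → ∞`
        (∀ n : ℕ+, n ≤ k → Tendsto (fun σ => lam σ n) atTop (𝓝 (dir k))) ∧
        (∀ n : ℕ+, k < n → ∃ Λ : ℝ, Tendsto (fun σ => lam σ n) atTop (𝓝 Λ) ∧ dir k < Λ)) ∧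
      DeltaFlow.nodalCount ℓ φ = (k : ℕ) := by
  open DeltaFlow in
  obtain ⟨q', hq', hqq⟩ := exists_bddMeas_ae_eq hq
  refine ⟨fun Z hZ σ => exists_isOrderedEigenvalues hℓ hZ hq' hqq, fun dir hdir k φ hφ hφ0 => ?_⟩
  obtain ⟨θ, hθ0, hθ, hzero⟩ := exists_angle_of_mem_dirichletEigenspace hℓ hq' hqq hφ hφ0
  have hB := hq'.const_sub (dir k)
  have hθℓ : θ ℓ = (k : ℕ) * Real.pi := by
    have h := (IsOrderedEigenvalues.strictMono_and_angle_eq (Z := ∅) hℓ (by simp) hq' hqq hdir).2 k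
    have h' := hθ.flow_eq hB hℓ.le
    rw [hθ0] at h'
    rw [Finset.sort_empty, angle, h'] at h
    exact h
  have hset : nodalSet ℓ φ = {x | x ∈ Ioo 0 ℓ ∧ Real.sin (θ x) = 0} := by
    ext x
    exact and_congr_right fun hx => hzero x (Ioo_subset_Icc_self hx)
  have hfin : (nodalSet ℓ φ).Finite := hset ▸ finite_zeros hB hθ hθ0 hθℓ
  obtain ⟨Z, hZ⟩ := hfin.exists_finset_coe
  refine ⟨Z, hZ, fun lam hlam => ?_, nodalCount_eq hB hθ hℓ hθ0 hθℓ hzero⟩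
  have hZs : (Z : Set ℝ) ⊆ Ioo 0 ℓ := fun x hx => by
    rw [hZ] at hx
    exact hx.1
  have hadm := adm_sort hℓ hZs
  have hmem : ∀ x ∈ Ioo 0 ℓ, Real.sin (θ x) = 0 ↔ x ∈ Z.sort := fun x hx => by
    rw [Finset.mem_sort, ← Finset.mem_coe, hZ, hset]
    exact (and_iff_right hx).symm
  have hang := fun σ => (hlam σ).strictMono_and_angle_eq hℓ hZs hq' hqq
  have hmono : ∀ σ, StrictMono fun t => angle (fun x => t - q' x) ℓ σ Z.sort 0 0 :=
    fun σ s t hst => angle_lt_angle hq' hst hadm le_rfl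
  have hlm : ∀ n : ℕ+, Monotone fun σ => lam σ n := fun n σ τ hστ => by
    refine (hmono τ).le_iff_le.1 ?_
    simp only
    rw [(hang τ).2, ← (hang σ).2]
    exact angle_mono (hq'.const_sub _) (hq'.const_sub _) (fun _ => le_rfl) hστ hadm le_rfl
  have hk : ∀ σ, lam σ k = dir k := fun σ => by
    refine (hmono σ).injective ?_
    rw [(hang σ).2]
    have := angle_eq_of_sin_eq_zero hB hθ σ hadm le_rfl fun z hz =>
      (hmem z ⟨hadm.lt_of_mem hz, hadm.mem_lt hz⟩).2 hz
    rw [hθ0, hθℓ] at this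
    exact this.symm
  refine ⟨fun σ => (hang σ).1, hlm, hk, fun n hn => ?_, fun n hn => ?_⟩
  · refine tendsto_order.2 ⟨fun s hs => ?_, fun s hs => Eventually.of_forall fun σ => ?_⟩
    -- For `s` below the Dirichlet eigenvalue the angle at `s` is eventually below `π ≤ n π`, so `s
    -- < lam σ n`.
    · have hgap := gap_of_lt hq' hs hθ hadm le_rfl (by simp [hθ0]) hmem
      filter_upwards [hgap.eventually_angle_lt (hq'.const_sub s) hadm] with σ hσ
      refine (hmono σ).lt_iff_lt.1 (hσ.trans_le ?_)
      rw [(hang σ).2]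
      have : (1 : ℝ) ≤ n := by exact_mod_cast n.pos
      nlinarith [Real.pi_pos]
    · refine lt_of_le_of_lt ?_ hs
      rw [← hk σ]
      exact (hang σ).1.monotone hn
  · obtain ⟨T, hT⟩ := exists_le_angle hq' (n * Real.pi) hadm
    have hbdd : BddAbove (range fun σ => lam σ n) := by
      refine ⟨T, ?_⟩
      rintro _ ⟨σ, rfl⟩
      refine (hmono σ).le_iff_le.1 ?_
      simp only
      rw [(hang σ).2]
      exact hT T σ 0 le_rfl le_rfl
    refine ⟨_, tendsto_atTop_ciSup (hlm n) hbdd, ?_⟩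
    -- The limit is a supremum, so it is at least `lam 0 n`, which exceeds `lam 0 k = dir k` by
    -- simplicity.
    rw [← hk 0]
    exact ((hang 0).1 hn).trans_le (le_ciSup hbdd 0)
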